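/- Let $d\ge 2$, $q>\frac{2d}{d+2}$ and $V>0$. Consider bounded domains $\Omega\subset\mathbb{R}^d$ of class $C^2$ with volume $|\Omega|=V$, real numbers $\lambda>0$, nonnegative functions $H:\Omega\times\mathbb{R}^d\to[0,\infty)$, functions $f\in L^q(\Omega)$, and strong solutions $u$ of the Dirichlet problem $$-\Delta u+\lambda u+H(x,Du)=f\ \text{ in }\Omega,\qquad u=0\ \text{ on }\partial\Omega,$$ that is, functions $u\in W^{2,q}(\Omega)\cap W^{1,q}_0(\Omega)$ whose weak derivatives satisfy the equation almost everywhere in $\Omega$. Write $s^+=\max\{s,0\}$. (i) If $q<\frac d2$, there is a constant $C_0>0$, depending only on $d$, $q$ and $|\Omega|$ (and not on $\lambda$), such that $$\|u^+\|_{L^p(\Omega)}\le C_0\,\|f^+\|_{L^q(\Omega)},\qquad p=\frac{dq}{d-2q},$$ for all such $\Omega,\lambda,H,f,u$. (ii) If $q>\frac d2$, then for every $\lambda>0$ there is a constant $C_0>0$, depending only on $d$, $q$, $|\Omega|$ and $\lambda$, such that $$\|u^+\|_{L^\infty(\Omega)}\le C_0\,\|f^+\|_{L^q(\Omega)}$$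 for all such $\Omega,H,f,u$. -/

import Mathlib

open MeasureTheory
open scoped ENNReal ContDiff

/-- A bounded domain (nonempty, open, connected, bounded set) of class `C²`: near every boundary
point the domain is, after a rotation of the axes, the strict epigraph of a `C²` function.  The
unit vector `e` is the vertical axis and `x - ⟨e, x⟩ e` is the horizontal part of `x`, so only the
values of `γ` on the hyperplane orthogonal to `e` matter. -/
structure IsBoundedC2Domain {d : ℕ} (Ω : Set (EuclideanSpace ℝ (Fin d))) : Prop where
  isOpen : IsOpen Ω
  isConnected : IsConnected Ω
  isBounded : Bornology.IsBounded Ω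
  boundary : ∀ x₀ ∈ frontier Ω,
    ∃ (r : ℝ) (e : EuclideanSpace ℝ (Fin d)) (γ : EuclideanSpace ℝ (Fin d) → ℝ),
      0 < r ∧ ‖e‖ = 1 ∧ ContDiff ℝ 2 γ ∧
      ∀ x ∈ Metric.ball x₀ r, x ∈ Ω ↔ γ (x - inner ℝ e x • e) < inner ℝ e x

/-- `G` is the weak (distributional) gradient of `u` in `Ω`. -/
structure HasWeakGradientOn {d : ℕ} (Ω : Set (EuclideanSpace ℝ (Fin d)))
    (u : EuclideanSpace ℝ (Fin d) → ℝ)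
    (G : EuclideanSpace ℝ (Fin d) → EuclideanSpace ℝ (Fin d)) : Prop where
  locallyIntegrableOn : LocallyIntegrableOn u Ω
  locallyIntegrableOn_gradient : LocallyIntegrableOn G Ω
  integral_eq : ∀ (i : Fin d) (φ : EuclideanSpace ℝ (Fin d) → ℝ),
    ContDiff ℝ ∞ φ → HasCompactSupport φ → tsupport φ ⊆ Ω →
    ∫ x in Ω, u x * fderiv ℝ φ x (EuclideanSpace.single i 1) = - ∫ x in Ω, G x i * φ x

/-- `D2u` is the weak Hessian of a function with weak gradient `Du`: `D2u i` is the weak gradient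
of the `i`-th component of `Du`, so that `D2u i x j` is the second derivative in `x_i, x_j`. -/
def HasWeakHessianOn {d : ℕ} (Ω : Set (EuclideanSpace ℝ (Fin d)))
    (Du : EuclideanSpace ℝ (Fin d) → EuclideanSpace ℝ (Fin d))
    (D2u : Fin d → EuclideanSpace ℝ (Fin d) → EuclideanSpace ℝ (Fin d)) : Prop :=
  ∀ i, HasWeakGradientOn Ω (fun x => Du x i) (D2u i)

/-- The Sobolev space `W^{2,q}(Ω)`. -/
def MemW2 {d : ℕ} (Ω : Set (EuclideanSpace ℝ (Fin d))) (q : ℝ≥0∞)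
    (u : EuclideanSpace ℝ (Fin d) → ℝ) : Prop :=
  MemLp u q (volume.restrict Ω) ∧
  ∃ (Du : EuclideanSpace ℝ (Fin d) → EuclideanSpace ℝ (Fin d))
    (D2u : Fin d → EuclideanSpace ℝ (Fin d) → EuclideanSpace ℝ (Fin d)),
    HasWeakGradientOn Ω u Du ∧ HasWeakHessianOn Ω Du D2u ∧
    MemLp Du q (volume.restrict Ω) ∧ ∀ i, MemLp (D2u i) q (volume.restrict Ω)

/-- The Sobolev space `W^{1,q}_0(Ω)`: the closure in `W^{1,q}(Ω)` of the `C¹` functions with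
compact support in `Ω`. -/
def MemW10 {d : ℕ} (Ω : Set (EuclideanSpace ℝ (Fin d))) (q : ℝ≥0∞)
    (u : EuclideanSpace ℝ (Fin d) → ℝ) : Prop :=
  MemLp u q (volume.restrict Ω) ∧
  ∃ Du : EuclideanSpace ℝ (Fin d) → EuclideanSpace ℝ (Fin d),
    HasWeakGradientOn Ω u Du ∧ MemLp Du q (volume.restrict Ω) ∧
    ∀ ε : ℝ≥0∞, 0 < ε → ∃ φ : EuclideanSpace ℝ (Fin d) → ℝ,
      ContDiff ℝ 1 φ ∧ HasCompactSupport φ ∧ tsupport φ ⊆ Ω ∧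
      eLpNorm (fun x => u x - φ x) q (volume.restrict Ω) < ε ∧
      eLpNorm (fun x => Du x - gradient φ x) q (volume.restrict Ω) < ε

/-- `u ∈ W^{2,q}(Ω) ∩ W^{1,q}_0(Ω)` is a strong solution of the Dirichlet problem
`-Δu + lam u + H(x, Du) = f` in `Ω`, `u = 0` on `∂Ω`: the equation holds almost everywhere in `Ω`
for the weak derivatives of `u`. -/
structure IsStrongSolution {d : ℕ} (Ω : Set (EuclideanSpace ℝ (Fin d))) (q : ℝ≥0∞) (lam : ℝ)
    (H : EuclideanSpace ℝ (Fin d) → EuclideanSpace ℝ (Fin d) → ℝ)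
    (f u : EuclideanSpace ℝ (Fin d) → ℝ) : Prop where
  memW2 : MemW2 Ω q u
  memW10 : MemW10 Ω q u
  equation : ∃ (Du : EuclideanSpace ℝ (Fin d) → EuclideanSpace ℝ (Fin d))
    (D2u : Fin d → EuclideanSpace ℝ (Fin d) → EuclideanSpace ℝ (Fin d)),
    HasWeakGradientOn Ω u Du ∧ HasWeakHessianOn Ω Du D2u ∧
    ∀ᵐ x ∂(volume.restrict Ω), - (∑ i, D2u i x i) + lam * u x + H x (Du x) = f x

/-! ### Pointwise differential calculus and integration by parts. -/

section Calculus

open Filter Topology Convolution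

variable {d : ℕ}

local notation "𝔼" => EuclideanSpace ℝ (Fin d)

/-! Since `H` is nonnegative, the equation gives `-Δu + lam u ≤ f`, first almost everywhere and
then, after two integrations by parts against a test function, in the sense of distributions
(`IsStrongSolution.isWeakSubsolution`). Kato's inequality (`IsWeakSubsolution.kato`) turns this into
`-Δu⁺ + lam u⁺ ≤ f⁺` in `Ω`. The Hamiltonian has then disappeared.

The second point is that the extension of `u⁺` by zero is a subsolution on the whole space: a
nonnegative function with zero boundary values can only acquire a nonnegative singular Laplacian on
the boundary. No traces are used. Membership in `W^{1,q}_0` and the graph description of the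
boundary give an `L¹` norm of size `o(δ)` on a collar of width `δ` (`MemW10.exists_collar_bound`).
Test functions are cut off near the boundary by a profile `θ` of the height above the graph, concave
except in a much thinner collar. Concavity has the favourable sign, and the two independent widths
make the remaining errors vanish (`subsolution_across_boundary`). A Lebesgue number for the boundary
charts globalizes this (`IsStrongSolution.exists_mollify_posPart_subsolution`).

Mollification now yields smooth, compactly supported `v, F ≥ 0` with `lam v - F ≤ Δv` everywhere, so
it suffices to prove a priori bounds for such pairs.

For `q < d/2` (`exists_Lp_estimate`), test with `v ^ m`, apply Sobolev's inequality to `v ^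
((m+1)/2)` and Hölder's to `F v ^ m`. One `m` makes both produce the integral of `v ^ p`, and the
lower bound on `q` says exactly that `m > 1`. The zeroth order term has a good sign and is dropped,
so `lam` does not enter the constant.

For `q > d/2` (`exists_sup_estimate`), consider a weighted mean of `v` over the ball of radius `r`
about a point. Its derivative in `r` is an integral of `Δv`, hence at least `-c r ^ (1 - d/q)` times
the `L^q` norm of `F`, and this power is integrable at `0`. Thus `v` at the centre is controlled by
the mean at radius `1`, which is controlled by the mass of `v`. Integrating the inequality bounds
that mass by the mass of `F` divided by `lam`, and Hölder on `Ω` brings in the volume.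

Lower semicontinuity of the norms along the mollifications (`IsStrongSolution.eLpNorm_posPart_le`)
returns to `u⁺`. -/

/-- The `i`-th partial derivative. -/
noncomputable def pderiv (i : Fin d) (g : 𝔼 → ℝ) : 𝔼 → ℝ :=
  fun x => fderiv ℝ g x (EuclideanSpace.single i 1)

/-- The Laplacian, as the sum of the second partial derivatives. -/
noncomputable def laplace (g : 𝔼 → ℝ) : 𝔼 → ℝ :=
  fun x => ∑ i, pderiv i (pderiv i g) x

lemma ContDiff.pderiv {m n : WithTop ℕ∞} {g : 𝔼 → ℝ} (hg : ContDiff ℝ n g) (h : m + 1 ≤ n)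
    (i : Fin d) : ContDiff ℝ m (pderiv i g) :=
  (hg.fderiv_right h).clm_apply contDiff_const

lemma ContDiff.continuous_laplace {g : 𝔼 → ℝ} (hg : ContDiff ℝ 2 g) : Continuous (laplace g) :=
  continuous_finsetSum _ fun i _ =>
    ((hg.pderiv (m := 1) le_rfl i).pderiv (m := 0) le_rfl i).continuous

lemma HasCompactSupport.pderiv {g : 𝔼 → ℝ} (hg : HasCompactSupport g) (i : Fin d) :
    HasCompactSupport (pderiv i g) :=
  hg.fderiv_apply ℝ _

lemma tsupport_pderiv_subset (g : 𝔼 → ℝ) (i : Fin d) : tsupport (pderiv i g) ⊆ tsupport g :=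
  tsupport_fderiv_apply_subset ℝ _

lemma laplace_eq_zero_of_notMem_tsupport {g : 𝔼 → ℝ} {x : 𝔼} (hx : x ∉ tsupport g) :
    laplace g x = 0 :=
  Finset.sum_eq_zero fun i _ => image_eq_zero_of_notMem_tsupport fun h =>
    hx (tsupport_pderiv_subset g i (tsupport_pderiv_subset _ i h))

lemma HasCompactSupport.laplace {g : 𝔼 → ℝ} (hg : HasCompactSupport g) :
    HasCompactSupport (laplace g) :=
  HasCompactSupport.intro hg fun _ hx => laplace_eq_zero_of_notMem_tsupport hx

lemma pderiv_mul {f g : 𝔼 → ℝ} {x : 𝔼} (hf : DifferentiableAt ℝ f x) (hg : DifferentiableAt ℝ g x)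
    (i : Fin d) :
    pderiv i (fun y => f y * g y) x = pderiv i f x * g x + f x * pderiv i g x := by
  have := fderiv_fun_mul hf hg
  simp only [pderiv, this, add_apply, FunLike.coe_smul, Pi.smul_apply, smul_eq_mul]
  ring

lemma pderiv_comp {h : ℝ → ℝ} {h' : ℝ} {g : 𝔼 → ℝ} {x : 𝔼} (hh : HasDerivAt h h' (g x))
    (hg : DifferentiableAt ℝ g x) (i : Fin d) :
    pderiv i (fun y => h (g y)) x = h' * pderiv i g x := by
  have := (hh.comp_hasFDerivAt x hg.hasFDerivAt).fderiv
  simp only [pderiv]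
  change fderiv ℝ (h ∘ g) x _ = _
  simp [this]

lemma pderiv_add {f g : 𝔼 → ℝ} {x : 𝔼} (hf : DifferentiableAt ℝ f x) (hg : DifferentiableAt ℝ g x)
    (i : Fin d) :
    pderiv i (fun y => f y + g y) x = pderiv i f x + pderiv i g x := by
  simp [pderiv, fderiv_fun_add hf hg]

lemma laplace_mul {f g : 𝔼 → ℝ} (hf : ContDiff ℝ 2 f) (hg : ContDiff ℝ 2 g) (x : 𝔼) :
    laplace (fun y => f y * g y) x
      = laplace f x * g x + 2 * ∑ i, pderiv i f x * pderiv i g x + f x * laplace g x := by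
  have hf1 : Differentiable ℝ f := hf.differentiable (by norm_num)
  have hg1 : Differentiable ℝ g := hg.differentiable (by norm_num)
  have hf2 : ∀ i, Differentiable ℝ (pderiv i f) := fun i =>
    (hf.pderiv (m := 1) le_rfl i).differentiable (by norm_num)
  have hg2 : ∀ i, Differentiable ℝ (pderiv i g) := fun i =>
    (hg.pderiv (m := 1) le_rfl i).differentiable (by norm_num)
  simp only [laplace, Finset.sum_mul, Finset.mul_sum, ← Finset.sum_add_distrib]
  refine Finset.sum_congr rfl fun i _ => ?_
  have : pderiv i (fun y => f y * g y) = fun y => pderiv i f y * g y + f y * pderiv i g y :=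
    funext fun y => pderiv_mul (hf1 y) (hg1 y) i
  rw [this, pderiv_add ((hf2 i x).fun_mul (hg1 x)) ((hf1 x).fun_mul (hg2 i x)),
    pderiv_mul (hf2 i x) (hg1 x), pderiv_mul (hf1 x) (hg2 i x)]
  ring

lemma laplace_comp {h h' h'' : ℝ → ℝ} {g : 𝔼 → ℝ} (hg : ContDiff ℝ 2 g)
    (hh : ∀ s, HasDerivAt h (h' s) s) (hh' : ∀ s, HasDerivAt h' (h'' s) s) (x : 𝔼) :
    laplace (fun y => h (g y)) x
      = h'' (g x) * ∑ i, pderiv i g x ^ 2 + h' (g x) * laplace g x := by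
  have hg1 : Differentiable ℝ g := hg.differentiable (by norm_num)
  have hg2 : ∀ i, Differentiable ℝ (pderiv i g) := fun i =>
    (hg.pderiv (m := 1) le_rfl i).differentiable (by norm_num)
  simp only [laplace, Finset.mul_sum, ← Finset.sum_add_distrib]
  refine Finset.sum_congr rfl fun i _ => ?_
  have : pderiv i (fun y => h (g y)) = fun y => h' (g y) * pderiv i g y :=
    funext fun y => pderiv_comp (hh _) (hg1 y) i
  rw [this, pderiv_mul (f := fun y => h' (g y)) (((hh' (g x)).differentiableAt).comp x (hg1 x)) (hg2 i x),
    pderiv_comp (hh' _) (hg1 x)]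
  ring

lemma pderiv_comp_sub_left {g : 𝔼 → ℝ} (hg : Differentiable ℝ g) (x y : 𝔼) (i : Fin d) :
    pderiv i (fun t => g (x - t)) y = - pderiv i g (x - y) := by
  have := ((hg (x - y)).hasFDerivAt.comp y ((hasFDerivAt_id y).const_sub x)).fderiv
  simp only [pderiv]
  change fderiv ℝ (g ∘ fun t => x - t) y _ = _
  rw [show (fun t => x - t) = HSub.hSub x from rfl, this]
  simp

lemma laplace_comp_sub_left {g : 𝔼 → ℝ} (hg : ContDiff ℝ 2 g) (x y : 𝔼) :
    laplace (fun t => g (x - t)) y = laplace g (x - y) := by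
  refine Finset.sum_congr rfl fun i _ => ?_
  have : pderiv i (fun t => g (x - t)) = fun t => - pderiv i g (x - t) :=
    funext fun y => pderiv_comp_sub_left (hg.differentiable two_ne_zero) x y i
  have h2 := pderiv_comp_sub_left
    ((hg.pderiv (m := 1) le_rfl i).differentiable one_ne_zero) x y i
  simp only [pderiv] at h2 this ⊢
  rw [this, fderiv_fun_neg, neg_apply, h2, neg_neg]

/-- Integration by parts against a compactly supported function. -/
lemma integral_mul_pderiv {f g : 𝔼 → ℝ} (hf : ContDiff ℝ 1 f) (hg : ContDiff ℝ 1 g)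
    (hgc : HasCompactSupport g) (i : Fin d) :
    ∫ x, f x * pderiv i g x = - ∫ x, pderiv i f x * g x := by
  have hf' := (hf.pderiv (m := 0) le_rfl i).continuous
  have hg' := (hg.pderiv (m := 0) le_rfl i).continuous
  refine integral_mul_fderiv_eq_neg_fderiv_mul_of_integrable ?_ ?_ ?_
    (fun x _ => hf.differentiable one_ne_zero x) (fun x _ => hg.differentiable one_ne_zero x)
  · exact (hf'.mul hg.continuous).integrable_of_hasCompactSupport hgc.mul_left
  · exact (hf.continuous.mul hg').integrable_of_hasCompactSupport (hgc.pderiv i).mul_left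
  · exact (hf.continuous.mul hg.continuous).integrable_of_hasCompactSupport hgc.mul_left

lemma integral_mul_laplace {f g : 𝔼 → ℝ} (hf : ContDiff ℝ 1 f) (hg : ContDiff ℝ 2 g)
    (hgc : HasCompactSupport g) :
    ∫ x, f x * laplace g x = - ∫ x, ∑ i, pderiv i f x * pderiv i g x := by
  simp only [laplace, Finset.mul_sum]
  have hf' := fun i => (hf.pderiv (m := 0) le_rfl i).continuous
  have hg1 := fun i => hg.pderiv (m := 1) le_rfl i
  have hg2 := fun i => ((hg1 i).pderiv (m := 0) le_rfl i).continuous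
  rw [integral_finsetSum, integral_finsetSum, ← Finset.sum_neg_distrib]
  · exact Finset.sum_congr rfl fun i _ => integral_mul_pderiv hf (hg1 i) (hgc.pderiv i) i
  · exact fun i _ => ((hf' i).mul (hg1 i).continuous).integrable_of_hasCompactSupport
      (hgc.pderiv i).mul_left
  · exact fun i _ => (hf.continuous.mul (hg2 i)).integrable_of_hasCompactSupport
      ((hgc.pderiv i).pderiv i).mul_left

lemma integral_mul_laplace_left {f g : 𝔼 → ℝ} (hf : ContDiff ℝ 2 f) (hg : ContDiff ℝ 1 g)
    (hgc : HasCompactSupport g) :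
    ∫ x, laplace f x * g x = - ∫ x, ∑ i, pderiv i f x * pderiv i g x := by
  simp only [laplace, Finset.sum_mul]
  have hf1 := fun i => hf.pderiv (m := 1) le_rfl i
  have hf2 := fun i => ((hf1 i).pderiv (m := 0) le_rfl i).continuous
  have hg' := fun i => (hg.pderiv (m := 0) le_rfl i).continuous
  rw [integral_finsetSum, integral_finsetSum, ← Finset.sum_neg_distrib]
  · refine Finset.sum_congr rfl fun i _ => ?_
    rw [integral_mul_pderiv (hf1 i) hg hgc i, neg_neg]
  · exact fun i _ => ((hf1 i).continuous.mul (hg' i)).integrable_of_hasCompactSupport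
      (hgc.pderiv i).mul_left
  · exact fun i _ => ((hf2 i).mul hg.continuous).integrable_of_hasCompactSupport hgc.mul_left

/-! ### Mollification. -/

/-- Mollification by a normalized bump function. -/
noncomputable def mollify (φ : ContDiffBump (0 : 𝔼)) (g : 𝔼 → ℝ) : 𝔼 → ℝ :=
  φ.normed volume ⋆[ContinuousLinearMap.lsmul ℝ ℝ, volume] g

lemma mollify_apply (φ : ContDiffBump (0 : 𝔼)) (g : 𝔼 → ℝ) (x : 𝔼) :
    mollify φ g x = ∫ t, φ.normed volume (x - t) * g t := by
  simp [mollify, convolution_lsmul_swap]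

lemma contDiff_mollify (φ : ContDiffBump (0 : 𝔼)) {g : 𝔼 → ℝ} (hg : Integrable g) {n : ℕ∞} :
    ContDiff ℝ n (mollify φ g) :=
  φ.hasCompactSupport_normed.contDiff_convolution_left _ φ.contDiff_normed hg.locallyIntegrable

lemma pderiv_convolution {k g : 𝔼 → ℝ} (hk : ContDiff ℝ 1 k) (hkc : HasCompactSupport k)
    (hg : LocallyIntegrable g) (i : Fin d) :
    pderiv i (k ⋆[ContinuousLinearMap.lsmul ℝ ℝ, volume] g)
      = pderiv i k ⋆[ContinuousLinearMap.lsmul ℝ ℝ, volume] g := by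
  funext x
  have h := (hkc.hasFDerivAt_convolution_left (ContinuousLinearMap.lsmul ℝ ℝ) hk hg x).fderiv
  have hint : Integrable fun t =>
      ((ContinuousLinearMap.lsmul ℝ ℝ).precompL 𝔼 (fderiv ℝ k (x - t))) (g t) :=
    ((hkc.fderiv ℝ).convolutionExists_left _ (hk.continuous_fderiv one_ne_zero) hg
      x).integrable_swap
  simp only [pderiv, h]
  rw [convolution_eq_swap, convolution_eq_swap, ContinuousLinearMap.integral_apply hint]
  rfl

/-- Both derivatives fall on the kernel, and the reflection `t ↦ x - t` leaves the Laplacian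
unchanged because its two signs cancel. The Laplacian of a mollification is therefore a
distributional pairing with a shifted bump, the bridge from weak to pointwise inequalities. -/
lemma laplace_mollify (φ : ContDiffBump (0 : 𝔼)) {g : 𝔼 → ℝ} (hg : Integrable g) (x : 𝔼) :
    laplace (mollify φ g) x = ∫ t, g t * laplace (fun s => φ.normed volume (x - s)) t := by
  have hk : ContDiff ℝ 2 (φ.normed (volume : Measure 𝔼)) := φ.contDiff_normed (n := 2)
  have hkc := φ.hasCompactSupport_normed (μ := (volume : Measure 𝔼))
  have hl := hg.locallyIntegrable
  have h1 := fun i => hk.pderiv (m := 1) le_rfl i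
  have h2 := fun i => ((h1 i).pderiv (m := 0) le_rfl i).continuous
  simp only [laplace, mollify, pderiv_convolution (hk.of_le one_le_two) hkc hl,
    pderiv_convolution (h1 _) (hkc.pderiv _) hl, convolution_lsmul_swap, smul_eq_mul]
  rw [← integral_finsetSum]
  · refine integral_congr_ae (Eventually.of_forall fun t => ?_)
    have := laplace_comp_sub_left hk x t
    simp only [laplace] at this
    simp only [this, Finset.mul_sum, mul_comm]
  · intro i _
    simpa using (((hkc.pderiv i).pderiv i).convolutionExists_left
      (ContinuousLinearMap.lsmul ℝ ℝ) (h2 i) hl x).integrable_swap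

lemma integrable_mollify (φ : ContDiffBump (0 : 𝔼)) {g : 𝔼 → ℝ} (hg : Integrable g) :
    Integrable (mollify φ g) :=
  Integrable.integrable_convolution _ φ.integrable_normed hg

lemma integral_mollify (φ : ContDiffBump (0 : 𝔼)) {g : 𝔼 → ℝ} (hg : Integrable g) :
    ∫ x, mollify φ g x = ∫ x, g x := by
  rw [mollify, integral_convolution _ φ.integrable_normed hg]
  simp [φ.integral_normed]

lemma integrable_mollify_integrand (φ : ContDiffBump (0 : 𝔼)) {g : 𝔼 → ℝ} (hg : Integrable g)
    (x : 𝔼) : Integrable fun t => φ.normed volume (x - t) * g t := by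
  simpa using (φ.hasCompactSupport_normed.convolutionExists_left
      (ContinuousLinearMap.lsmul ℝ ℝ) φ.continuous_normed hg.locallyIntegrable x).integrable_swap

lemma mollify_nonneg (φ : ContDiffBump (0 : 𝔼)) {g : 𝔼 → ℝ} (h : ∀ x, 0 ≤ g x) (x : 𝔼) :
    0 ≤ mollify φ g x := by
  rw [mollify_apply]
  exact integral_nonneg fun t => mul_nonneg (φ.nonneg_normed _) (h t)

lemma abs_mollify_le (φ : ContDiffBump (0 : 𝔼)) (g : 𝔼 → ℝ) (x : 𝔼) :
    |mollify φ g x| ≤ mollify φ (fun y => |g y|) x := by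
  simp only [mollify_apply]
  refine (abs_integral_le_integral_abs).trans_eq (integral_congr_ae (Eventually.of_forall fun t => ?_))
  simp [abs_mul, abs_of_nonneg (φ.nonneg_normed _)]

/-- A sequence of bump functions shrinking to the origin. -/
noncomputable def shrinkingBump (n : ℕ) : ContDiffBump (0 : 𝔼) where
  rIn := 1 / (2 * ((n : ℝ) + 1))
  rOut := 1 / ((n : ℝ) + 1)
  rIn_pos := by positivity
  rIn_lt_rOut := by
    have : (0 : ℝ) < (n : ℝ) + 1 := by positivity
    exact one_div_lt_one_div_of_lt this (by linarith)

lemma tendsto_shrinkingBump_rOut :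
    Tendsto (fun n => (shrinkingBump n : ContDiffBump (0 : 𝔼)).rOut) atTop (𝓝 0) :=
  tendsto_one_div_add_atTop_nhds_zero_nat

lemma ae_tendsto_mollify {g : 𝔼 → ℝ} (hg : Integrable g) :
    ∀ᵐ x, Tendsto (fun n => mollify (shrinkingBump n) g x) atTop (𝓝 (g x)) := by
  refine ContDiffBump.ae_convolution_tendsto_right_of_locallyIntegrable (K := 2)
    tendsto_shrinkingBump_rOut (Eventually.of_forall fun n => ?_) hg.locallyIntegrable
  simp only [shrinkingBump]
  have : (0 : ℝ) < (n : ℝ) + 1 := by positivity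
  field_simp
  norm_num

/-- Mollifications converge in `L¹`. -/
lemma tendsto_integral_abs_mollify_sub {g : 𝔼 → ℝ} (hg : Integrable g) :
    Tendsto (fun n => ∫ x, |mollify (shrinkingBump n) g x - g x|) atTop (𝓝 0) := by
  set a : ℕ → ℝ := fun n => ∫ x, |mollify (shrinkingBump n) g x - g x|
  -- A Scheffé-type argument: `G n` is nonnegative and tends almost everywhere to `2|g|`, so Fatou
  -- bounds `2∫|g|` by the lower limit of `2∫|g| - a n`, which forces `a n → 0`.
  set G : ℕ → 𝔼 → ℝ := fun n x => mollify (shrinkingBump n) (fun y => |g y|) x + |g x|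
    - |mollify (shrinkingBump n) g x - g x|
  have hm := fun n => integrable_mollify (shrinkingBump n) hg
  have hG : ∀ n, Integrable (G n) := fun n =>
    ((integrable_mollify _ hg.abs).add hg.abs).sub ((hm n).sub hg).abs
  have hG0 : ∀ n x, 0 ≤ G n x := fun n x => by
    have h1 := abs_mollify_le (shrinkingBump n) g x
    have h2 := abs_sub (mollify (shrinkingBump n) g x) (g x)
    simp only [G]
    linarith
  have hGi : ∀ n, ∫ x, G n x = 2 * (∫ x, |g x|) - a n := fun n => by
    simp only [G]
    have h1 : Integrable fun x => mollify (shrinkingBump n) (fun y => |g y|) x + |g x| :=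
      (integrable_mollify _ hg.abs).add hg.abs
    have h2 : Integrable fun x => |mollify (shrinkingBump n) g x - g x| := ((hm n).sub hg).abs
    rw [integral_sub h1 h2, integral_add (integrable_mollify _ hg.abs) hg.abs, integral_mollify _ hg.abs]
    ring
  have ha0 : ∀ n, 0 ≤ a n := fun n => integral_nonneg fun x => abs_nonneg _
  have ha1 : ∀ n, a n ≤ 2 * ∫ x, |g x| := fun n => by
    have := hGi n ▸ integral_nonneg (hG0 n)
    linarith
  have hfatou : ENNReal.ofReal (2 * ∫ x, |g x|)
      ≤ liminf (fun n => ENNReal.ofReal (2 * (∫ x, |g x|) - a n)) atTop := by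
    have h1 := lintegral_liminf_le' (μ := volume) (u := atTop)
      (fun n => ((hG n).aestronglyMeasurable.aemeasurable).ennreal_ofReal)
    simp only [← ofReal_integral_eq_lintegral_ofReal (hG _) (ae_of_all _ (hG0 _)), hGi] at h1
    refine le_trans (le_of_eq ?_) h1
    rw [← integral_const_mul, ofReal_integral_eq_lintegral_ofReal (hg.abs.const_mul 2)
      (ae_of_all _ fun x => by positivity)]
    refine lintegral_congr_ae ?_
    filter_upwards [ae_tendsto_mollify hg, ae_tendsto_mollify hg.abs] with x h1 h2
    have h3 : Tendsto (fun n => G n x) atTop (𝓝 (2 * |g x|)) := by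
      have := (h2.add_const (|g x|)).sub ((h1.sub_const (g x)).abs)
      convert this using 2
      simp
      ring
    exact ((ENNReal.continuous_ofReal.tendsto _).comp h3).liminf_eq.symm
  rw [Metric.tendsto_nhds]
  intro ε hε
  -- `ENNReal.ofReal` truncates at zero, so the strict comparison used below needs a positive
  -- integral.
  by_cases hI : (∫ x, |g x|) = 0
  · refine Eventually.of_forall fun n => ?_
    have : a n = 0 := le_antisymm (by simpa [hI] using ha1 n) (ha0 n)
    simpa [this] using hε
  have hI' : 0 < ∫ x, |g x| := lt_of_le_of_ne (integral_nonneg fun x => abs_nonneg _) (Ne.symm hI)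
  have hlt : ENNReal.ofReal (2 * (∫ x, |g x|) - ε)
      < liminf (fun n => ENNReal.ofReal (2 * (∫ x, |g x|) - a n)) atTop :=
    lt_of_lt_of_le ((ENNReal.ofReal_lt_ofReal_iff (by positivity)).2 (by linarith)) hfatou
  filter_upwards [eventually_lt_of_lt_liminf hlt] with n hn
  have := (ENNReal.ofReal_lt_ofReal_iff').1 hn
  rw [Real.dist_eq, sub_zero, abs_of_nonneg (ha0 n)]
  linarith [this.1]

end Calculus

/-! ### Kato's inequality for weak subsolutions. -/

section Kato

open Filter Topology

variable {d : ℕ}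

local notation "𝔼" => EuclideanSpace ℝ (Fin d)

/-- Smooth convex approximations of the positive part. -/
lemma exists_smooth_posPart {c : ℝ} (hc : 0 < c) :
    ∃ j j' j'' : ℝ → ℝ, ContDiff ℝ 2 j ∧ ContDiff ℝ 1 j' ∧ Continuous j'' ∧
      (∀ s, HasDerivAt j (j' s) s) ∧ (∀ s, HasDerivAt j' (j'' s) s) ∧ (∀ s, 0 ≤ j'' s) ∧
      (∀ s, 0 ≤ j' s) ∧ (∀ s, j' s ≤ 1) ∧ (∀ s, |j s - max s 0| ≤ c) ∧
      ∀ s, max s 0 - c ≤ s * j' s := by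
  -- The approximation is `j s = (s + √(s² + c²)) / 2`. The lower bound on `s * j' s` is what later
  -- keeps the term `lam w j'(w)` close to `lam w⁺`.
  set r : ℝ → ℝ := fun s => √(s ^ 2 + c ^ 2)
  have hpos : ∀ s : ℝ, 0 < s ^ 2 + c ^ 2 := fun s => by positivity
  have hr : ∀ s, 0 < r s := fun s => Real.sqrt_pos.2 (hpos s)
  have hr2 : ∀ s, r s ^ 2 = s ^ 2 + c ^ 2 := fun s => Real.sq_sqrt (hpos s).le
  have hrs : ∀ s, |s| ≤ r s := fun s => Real.abs_le_sqrt (by nlinarith)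
  have hrc : ∀ s, r s ≤ |s| + c := fun s => by
    have := abs_nonneg s
    exact (Real.sqrt_le_left (by positivity)).2 (by nlinarith [sq_abs s])
  have hrd : ContDiff ℝ 2 r :=
    ((contDiff_id.pow 2).add contDiff_const).sqrt fun s => (hpos s).ne'
  have hr' : ∀ s, HasDerivAt r (s / r s) s := fun s => by
    have h := (((hasDerivAt_id s).pow 2).add_const (c ^ 2)).sqrt (hpos s).ne'
    refine h.congr_deriv ?_
    have := (hr s).ne'
    simp only [id, r] at this ⊢
    field_simp
    norm_num
    field_simp
  refine ⟨fun s => (s + r s) / 2, fun s => (1 + s / r s) / 2, fun s => c ^ 2 / (2 * r s ^ 3),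
    (contDiff_id.add hrd).div_const 2, ?_, ?_, ?_, ?_, ?_, ?_, ?_, ?_, ?_⟩
  · exact (contDiff_const.add (contDiff_id.div (hrd.of_le one_le_two)
      fun s => (hr s).ne')).div_const 2
  · exact continuous_const.div (continuous_const.mul (hrd.continuous.pow 3))
      fun s => by have := hr s; positivity
  · exact fun s => ((hasDerivAt_id s).add (hr' s)).div_const 2
  · intro s
    refine ((((hasDerivAt_id s).div (hr' s) (hr s).ne').const_add 1).div_const 2).congr_deriv ?_
    have := (hr s).ne'
    simp only [id]
    field_simp
    rw [hr2]
    ring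
  · exact fun s => by have := hr s; positivity
  · intro s
    have : -1 ≤ s / r s := by
      rw [le_div_iff₀ (hr s)]
      linarith [neg_abs_le s, hrs s]
    linarith
  · intro s
    have : s / r s ≤ 1 := (div_le_one (hr s)).2 ((le_abs_self s).trans (hrs s))
    linarith
  · intro s
    have h1 := hrs s
    have h2 := hrc s
    rcases le_total 0 s with h | h
    · rw [max_eq_left h, abs_le]
      rw [abs_of_nonneg h] at h1 h2
      constructor <;> linarith
    · rw [max_eq_right h, abs_le]
      rw [abs_of_nonpos h] at h1 h2
      constructor <;> linarith
  · intro s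
    have h1 := hrs s
    have h2 := hrc s
    have h3 : s * ((1 + s / r s) / 2) = (s + s ^ 2 / r s) / 2 := by ring
    have h4 : |s| - c ≤ s ^ 2 / r s := by
      rw [le_div_iff₀ (hr s), ← sq_abs s]
      nlinarith [abs_nonneg s, hr s]
    simp only [h3]
    rcases le_total 0 s with h | h
    · rw [max_eq_left h]
      rw [abs_of_nonneg h] at h4
      linarith
    · rw [max_eq_right h]
      rw [abs_of_nonpos h] at h4
      linarith

/-- Kato's inequality for `C²` functions, tested with a compactly supported function. -/
lemma kato_of_contDiff {lam : ℝ} (hlam : 0 ≤ lam) {w g η : 𝔼 → ℝ} (hw : ContDiff ℝ 2 w)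
    (hg : Continuous g) (hη : ContDiff ℝ 2 η) (hηc : HasCompactSupport η) (hη0 : ∀ x, 0 ≤ η x)
    (h : ∀ x ∈ tsupport η, lam * w x - g x ≤ laplace w x) :
    ∫ x, (lam * max (w x) 0 - max (g x) 0) * η x ≤ ∫ x, max (w x) 0 * laplace η x := by
  have hLc := hηc.laplace
  have hL := hη.continuous_laplace
  have hw0 := hw.continuous
  have hI1 : Integrable fun x => |laplace η x| := (hL.integrable_of_hasCompactSupport hLc).abs
  have hI2 : Integrable η := hη.continuous.integrable_of_hasCompactSupport hηc
  have key : ∀ c > 0, ∫ x, (lam * max (w x) 0 - max (g x) 0) * η x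
      ≤ (∫ x, max (w x) 0 * laplace η x)
        + c * ((∫ x, |laplace η x|) + lam * ∫ x, η x) := by
    intro c hc
    obtain ⟨j, j', j'', hj, hj1, hj2, hd, hd', h2, h1, h1', happ, hmul⟩ :=
      exists_smooth_posPart hc
    have hjw : ContDiff ℝ 1 fun x => j (w x) := (hj.comp hw).of_le one_le_two
    have hj'w : ContDiff ℝ 1 fun x => j' (w x) := hj1.comp (hw.of_le one_le_two)
    have hη1 : ContDiff ℝ 1 η := hη.of_le one_le_two
    have hdw : Differentiable ℝ w := hw.differentiable two_ne_zero
    have hpw := fun i => (hw.pderiv (m := 1) le_rfl i).continuous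
    have e1 := integral_mul_laplace hjw hη hηc
    have e2 := integral_mul_laplace_left hw (hj'w.mul hη1) hηc.mul_left
    -- The product rule splits off `j''(w) |∇w|² η`, nonnegative by convexity of `j`. Dropping it is
    -- the heart of the inequality: `∫ Δw j'(w) η ≤ ∫ j(w) Δη`.
    have e3 : ∀ x, ∑ i, pderiv i w x * pderiv i (fun y => j' (w y) * η y) x
        = ∑ i, pderiv i (fun y => j (w y)) x * pderiv i η x
          + (∑ i, pderiv i w x ^ 2) * j'' (w x) * η x := fun x => by
      rw [Finset.sum_mul, Finset.sum_mul, ← Finset.sum_add_distrib]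
      refine Finset.sum_congr rfl fun i _ => ?_
      rw [pderiv_mul (hj'w.differentiable one_ne_zero x) (hη1.differentiable one_ne_zero x),
        pderiv_comp (hd' _) (hdw x), pderiv_comp (hd _) (hdw x)]
      ring
    simp only [e3] at e2
    have i1 : Integrable fun x => ∑ i, pderiv i (fun y => j (w y)) x * pderiv i η x :=
      integrable_finsetSum _ fun i _ =>
        ((hjw.pderiv (m := 0) le_rfl i).continuous.mul
          (hη1.pderiv (m := 0) le_rfl i).continuous).integrable_of_hasCompactSupport
            (hηc.pderiv i).mul_left
    have i2 : Integrable fun x => (∑ i, pderiv i w x ^ 2) * j'' (w x) * η x :=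
      (((continuous_finsetSum _ fun i _ => (hpw i).pow 2).mul (hj2.comp hw0)).mul
        hη.continuous).integrable_of_hasCompactSupport hηc.mul_left
    rw [integral_add i1 i2] at e2
    have e4 : 0 ≤ ∫ x, (∑ i, pderiv i w x ^ 2) * j'' (w x) * η x :=
      integral_nonneg fun x => mul_nonneg (mul_nonneg (Finset.sum_nonneg fun i _ => sq_nonneg _)
        (h2 _)) (hη0 x)
    have e5 : ∫ x, laplace w x * (j' (w x) * η x) ≤ ∫ x, j (w x) * laplace η x := by
      linarith
    have e6 : ∫ x, j (w x) * laplace η x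
        ≤ (∫ x, max (w x) 0 * laplace η x) + c * ∫ x, |laplace η x| := by
      have i3 : Integrable fun x => max (w x) 0 * laplace η x :=
        ((hw0.max continuous_const).mul hL).integrable_of_hasCompactSupport hLc.mul_left
      rw [← integral_const_mul, ← integral_add i3 (hI1.const_mul c)]
      refine integral_mono ((hjw.continuous.mul hL).integrable_of_hasCompactSupport hLc.mul_left)
        (i3.add (hI1.const_mul c)) fun x => ?_
      have : (j (w x) - max (w x) 0) * laplace η x ≤ c * |laplace η x| := by
        refine (le_abs_self _).trans ?_
        rw [abs_mul]
        exact mul_le_mul_of_nonneg_right (happ _) (abs_nonneg _)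
      simp only
      linarith
    have e7 : (∫ x, (lam * max (w x) 0 - max (g x) 0) * η x) - c * (lam * ∫ x, η x)
        ≤ ∫ x, laplace w x * (j' (w x) * η x) := by
      have i4 : Integrable fun x => (lam * max (w x) 0 - max (g x) 0) * η x :=
        (((continuous_const.mul (hw0.max continuous_const)).sub
          (hg.max continuous_const)).mul hη.continuous).integrable_of_hasCompactSupport
            hηc.mul_left
      rw [← integral_const_mul, ← integral_const_mul,
        ← integral_sub i4 ((hI2.const_mul lam).const_mul c)]
      refine integral_mono (i4.sub ((hI2.const_mul lam).const_mul c))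
        ((hw.continuous_laplace.mul (hj'w.continuous.mul
          hη.continuous)).integrable_of_hasCompactSupport hηc.mul_left.mul_left) fun x => ?_
      simp only
      by_cases hx : x ∈ tsupport η
      · have a1 := mul_le_mul_of_nonneg_right (h x hx) (h1 (w x))
        have a2 := mul_le_mul_of_nonneg_left (hmul (w x)) hlam
        have a3 : g x * j' (w x) ≤ max (g x) 0 := by
          rcases le_total 0 (g x) with hgx | hgx
          · rw [max_eq_left hgx]
            exact mul_le_of_le_one_right hgx (h1' _)
          · rw [max_eq_right hgx]
            exact mul_nonpos_of_nonpos_of_nonneg hgx (h1 _)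
        have a4 : lam * max (w x) 0 - max (g x) 0 - c * lam ≤ laplace w x * j' (w x) := by
          nlinarith
        have := mul_le_mul_of_nonneg_right a4 (hη0 x)
        linarith
      · simp [image_eq_zero_of_notMem_tsupport hx]
    linarith
  -- The error is `c * K` with `K` independent of `c`, so `c` can be sent to zero.
  set K := (∫ x, |laplace η x|) + lam * ∫ x, η x
  have hK : 0 ≤ K := add_nonneg (integral_nonneg fun x => abs_nonneg _)
    (mul_nonneg hlam (integral_nonneg hη0))
  refine le_of_forall_pos_le_add fun ε hε => (key (ε / (K + 1)) (by positivity)).trans ?_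
  have : ε / (K + 1) * K ≤ ε := by
    rw [div_mul_eq_mul_div, div_le_iff₀ (by positivity)]
    nlinarith
  linarith

/-- `-Δv + lam v ≤ F` in `U` in the sense of distributions. -/
def IsWeakSubsolution (U : Set 𝔼) (lam : ℝ) (v F : 𝔼 → ℝ) : Prop :=
  ∀ ψ : 𝔼 → ℝ, ContDiff ℝ ∞ ψ → HasCompactSupport ψ → tsupport ψ ⊆ U → (∀ x, 0 ≤ ψ x) →
    ∫ x, (lam * v x - F x) * ψ x ≤ ∫ x, v x * laplace ψ x

lemma tsupport_bump_sub_subset (φ : ContDiffBump (0 : 𝔼)) (x : 𝔼) :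
    tsupport (fun t => φ.normed volume (x - t)) ⊆ Metric.closedBall x φ.rOut := by
  refine closure_minimal (fun t ht => ?_) Metric.isClosed_closedBall
  have h : x - t ∈ Metric.ball (0 : 𝔼) φ.rOut := by
    rw [← φ.support_normed_eq (μ := volume)]
    exact ht
  rw [mem_ball_zero_iff, ← dist_eq_norm, dist_comm] at h
  exact h.le

lemma contDiff_bump_sub (φ : ContDiffBump (0 : 𝔼)) (x : 𝔼) :
    ContDiff ℝ ∞ fun t => φ.normed volume (x - t) :=
  (φ.contDiff_normed (n := ⊤)).comp (contDiff_const.sub contDiff_id)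

lemma hasCompactSupport_bump_sub (φ : ContDiffBump (0 : 𝔼)) (x : 𝔼) :
    HasCompactSupport fun t => φ.normed volume (x - t) :=
  (isCompact_closedBall x φ.rOut).of_isClosed_subset (isClosed_tsupport _)
    (tsupport_bump_sub_subset φ x)

/-- The hypothesis is the weak inequality tested with the bump centred at `x`. The pointwise
inequality at `x` thus needs only that this single test function be admissible. -/
lemma mollify_sub_le_laplace_mollify {lam : ℝ} {v F : 𝔼 → ℝ} (hv : Integrable v)
    (hF : Integrable F) (φ : ContDiffBump (0 : 𝔼)) (x : 𝔼)
    (h : ∫ t, (lam * v t - F t) * φ.normed volume (x - t)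
      ≤ ∫ t, v t * laplace (fun s => φ.normed volume (x - s)) t) :
    lam * mollify φ v x - mollify φ F x ≤ laplace (mollify φ v) x := by
  rw [laplace_mollify φ hv, mollify_apply, mollify_apply, ← integral_const_mul,
    ← integral_sub ((integrable_mollify_integrand φ hv x).const_mul lam)
      (integrable_mollify_integrand φ hF x)]
  refine le_trans (le_of_eq (integral_congr_ae (Eventually.of_forall fun t => ?_))) h
  simp only
  ring

/-- The positive part is 1-Lipschitz and `k` is bounded, so convergence in `L¹` suffices. -/
lemma tendsto_integral_posPart_mul {g : ℕ → 𝔼 → ℝ} {g₀ k : 𝔼 → ℝ} (hg : ∀ n, Integrable (g n))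
    (hg₀ : Integrable g₀) (hk : Continuous k) (hkc : HasCompactSupport k)
    (h : Tendsto (fun n => ∫ x, |g n x - g₀ x|) atTop (𝓝 0)) :
    Tendsto (fun n => ∫ x, max (g n x) 0 * k x) atTop (𝓝 (∫ x, max (g₀ x) 0 * k x)) := by
  obtain ⟨C, hC⟩ := hk.bounded_above_of_compact_support hkc
  have hb : ∀ {f : 𝔼 → ℝ}, Integrable f → Integrable fun x => max (f x) 0 * k x := fun hf =>
    hf.pos_part.mul_bdd hk.aestronglyMeasurable (ae_of_all _ hC)
  rw [tendsto_iff_norm_sub_tendsto_zero]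
  refine squeeze_zero (fun n => norm_nonneg _) (fun n => ?_)
    (by simpa using h.const_mul C)
  rw [← integral_sub (hb (hg n)) (hb hg₀), ← integral_const_mul]
  refine norm_integral_le_of_norm_le (((hg n).sub hg₀).abs.const_mul C) (ae_of_all _ fun x => ?_)
  rw [← sub_mul, norm_mul, mul_comm]
  exact mul_le_mul (hC x) (abs_max_sub_max_le_abs _ _ _) (norm_nonneg _)
    ((norm_nonneg _).trans (hC x))

/-- Kato's inequality: the positive part of a weak subsolution is a weak subsolution, also for
`C²` test functions. -/
lemma IsWeakSubsolution.kato {U : Set 𝔼} (hU : IsOpen U) {lam : ℝ} (hlam : 0 ≤ lam)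
    {v F : 𝔼 → ℝ} (hv : Integrable v) (hF : Integrable F) (h : IsWeakSubsolution U lam v F)
    {η : 𝔼 → ℝ} (hη : ContDiff ℝ 2 η) (hηc : HasCompactSupport η) (hηU : tsupport η ⊆ U)
    (hη0 : ∀ x, 0 ≤ η x) :
    ∫ x, (lam * max (v x) 0 - max (F x) 0) * η x ≤ ∫ x, max (v x) 0 * laplace η x := by
  have hm := fun n => integrable_mollify (shrinkingBump n) hv
  have hmF := fun n => integrable_mollify (shrinkingBump n) hF
  obtain ⟨δ, hδ, hδU⟩ := hηc.isCompact.exists_cthickening_subset_open hU hηU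
  obtain ⟨C, hC⟩ := hη.continuous.bounded_above_of_compact_support hηc
  have hb : ∀ {f : 𝔼 → ℝ}, Integrable f → Integrable fun x => max (f x) 0 * η x := fun hf =>
    hf.pos_part.mul_bdd hη.continuous.aestronglyMeasurable (ae_of_all _ hC)
  have hsplit : ∀ {f g : 𝔼 → ℝ}, Integrable f → Integrable g →
      ∫ x, (lam * max (f x) 0 - max (g x) 0) * η x
        = lam * (∫ x, max (f x) 0 * η x) - ∫ x, max (g x) 0 * η x := fun hf hg => by
    rw [← integral_const_mul, ← integral_sub ((hb hf).const_mul lam) (hb hg)]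
    exact integral_congr_ae (Eventually.of_forall fun x => by simp only; ring)
  have hv0 := tendsto_integral_abs_mollify_sub hv
  have t1 := tendsto_integral_posPart_mul hm hv hη.continuous_laplace hηc.laplace hv0
  have t2 := tendsto_integral_posPart_mul hm hv hη.continuous hηc hv0
  have t3 := tendsto_integral_posPart_mul hmF hF hη.continuous hηc
    (tendsto_integral_abs_mollify_sub hF)
  rw [hsplit hv hF]
  refine le_of_tendsto_of_tendsto ((t2.const_mul lam).sub t3) t1 ?_
  -- Once the bump radius is below `δ`, bumps centred on the support of `η` are supported in `U`, so
  -- the smooth inequality holds wherever `η` sees it.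
  filter_upwards [tendsto_shrinkingBump_rOut.eventually (gt_mem_nhds hδ)] with n hn
  rw [← hsplit (hm n) (hmF n)]
  refine kato_of_contDiff hlam (contDiff_mollify _ hv (n := 2))
    (contDiff_mollify _ hF (n := 0)).continuous hη hηc hη0 fun x hx => ?_
  refine mollify_sub_le_laplace_mollify hv hF _ x (h _ (contDiff_bump_sub _ x)
    (hasCompactSupport_bump_sub _ x) ?_ fun t => (shrinkingBump n).nonneg_normed _)
  exact ((tsupport_bump_sub_subset _ x).trans ((Metric.closedBall_subset_closedBall hn.le).trans
    (Metric.closedBall_subset_cthickening hx δ))).trans hδU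

end Kato

/-! ### One-variable cutoff profiles. -/

section Cutoff

open Filter Topology

lemma contDiff_two_of_hasDerivAt {h h' h'' : ℝ → ℝ} (hh : ∀ s, HasDerivAt h (h' s) s)
    (hh' : ∀ s, HasDerivAt h' (h'' s) s) (hc : Continuous h'') : ContDiff ℝ 2 h := by
  have e : deriv h = h' := funext fun s => (hh s).deriv
  have e' : deriv h' = h'' := funext fun s => (hh' s).deriv
  rw [show (2 : WithTop ℕ∞) = 1 + 1 from rfl, contDiff_succ_iff_deriv]
  refine ⟨fun s => (hh s).differentiableAt, by simp, ?_⟩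
  rw [e, contDiff_one_iff_deriv, e']
  exact ⟨fun s => (hh' s).differentiableAt, hc⟩

/-- Only the origin needs care: there the function is dominated by `|t| ^ (n + 2)`, which is `o(t)`
because the exponent is at least two. -/
lemma hasDerivAt_max_zero_pow (n : ℕ) (s : ℝ) :
    HasDerivAt (fun t : ℝ => max t 0 ^ (n + 2)) ((n + 2) * max s 0 ^ (n + 1)) s := by
  rcases lt_trichotomy s 0 with h | h | h
  · rw [max_eq_right h.le]
    have : (fun t : ℝ => max t 0 ^ (n + 2)) =ᶠ[𝓝 s] fun _ => 0 := by
      filter_upwards [gt_mem_nhds h] with t ht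
      simp [max_eq_right ht.le]
    simpa using (hasDerivAt_const s (0 : ℝ)).congr_of_eventuallyEq this
  · subst h
    rw [max_self, zero_pow (by omega), mul_zero, hasDerivAt_iff_isLittleO]
    simp only [max_self, sub_zero, smul_zero, ne_eq, Nat.add_eq_zero_iff, OfNat.ofNat_ne_zero,
      and_false, not_false_eq_true, zero_pow]
    refine (Asymptotics.IsBigO.of_bound 1 (Eventually.of_forall fun t => ?_)).trans_isLittleO
      (Asymptotics.isLittleO_pow_id (n := n + 2) (by omega))
    rw [one_mul, norm_pow, norm_pow]
    refine pow_le_pow_left₀ (norm_nonneg _) ?_ _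
    rw [Real.norm_eq_abs, Real.norm_eq_abs, abs_of_nonneg (le_max_right _ _)]
    exact max_le (le_abs_self t) (abs_nonneg t)
  · rw [max_eq_left h.le]
    have : (fun t : ℝ => max t 0 ^ (n + 2)) =ᶠ[𝓝 s] fun t => t ^ (n + 2) := by
      filter_upwards [lt_mem_nhds h] with t ht
      simp [max_eq_left ht.le]
    refine ((hasDerivAt_pow (n + 2) s).congr_of_eventuallyEq this).congr_deriv ?_
    push_cast
    rfl

/-- A `C²` convex ramp: zero up to `1`, the identity minus `2` from `3` on. -/
lemma exists_convex_ramp : ∃ c c' c'' : ℝ → ℝ, (∀ s, HasDerivAt c (c' s) s) ∧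
    (∀ s, HasDerivAt c' (c'' s) s) ∧ Continuous c'' ∧ (∀ s ≤ 1, c s = 0) ∧ (∀ s, 0 ≤ c s) ∧
    (∀ s, 3 ≤ s → c s = s - 2) ∧ (∀ s, 0 ≤ c' s) ∧ (∀ s, c' s ≤ 1) ∧
    (∀ s, c'' s ≤ 1) ∧ (∀ s, 3 ≤ s → c'' s = 0) := by
  have hd : ∀ (n : ℕ) (a s : ℝ), HasDerivAt (fun t : ℝ => max (t - a) 0 ^ (n + 2))
      ((n + 2) * max (s - a) 0 ^ (n + 1)) s := fun n a s => by
    simpa using (hasDerivAt_max_zero_pow n (s - a)).comp_sub_const s a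
  have m1 : ∀ {s a : ℝ}, a ≤ s → max (s - a) 0 = s - a := fun h => max_eq_left (by linarith)
  have m2 : ∀ {s a : ℝ}, s ≤ a → max (s - a) 0 = 0 := fun h => max_eq_right (by linarith)
  -- A cubic spline: its second derivative is the hat function on `[1, 3]` with peak `1` at `2`, of
  -- total mass one, so the slope rises from `0` to `1`.
  refine ⟨fun s => (max (s - 1) 0 ^ 3 - 2 * max (s - 2) 0 ^ 3 + max (s - 3) 0 ^ 3) / 6,
    fun s => (max (s - 1) 0 ^ 2 - 2 * max (s - 2) 0 ^ 2 + max (s - 3) 0 ^ 2) / 2,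
    fun s => max (s - 1) 0 - 2 * max (s - 2) 0 + max (s - 3) 0, ?_, ?_, by fun_prop,
    ?_, ?_, ?_, ?_, ?_, ?_, ?_⟩
  · intro s
    refine ((((hd 1 1 s).sub ((hd 1 2 s).const_mul 2)).add (hd 1 3 s)).div_const 6).congr_deriv ?_
    norm_num
    ring
  · intro s
    refine ((((hd 0 1 s).sub ((hd 0 2 s).const_mul 2)).add (hd 0 3 s)).div_const 2).congr_deriv ?_
    norm_num
    ring
  · intro s hs
    simp [m2 hs, m2 (show s ≤ 2 by linarith), m2 (show s ≤ 3 by linarith)]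
  · intro s
    rcases le_total s 1 with h | h
    · simp [m2 h, m2 (show s ≤ 2 by linarith), m2 (show s ≤ 3 by linarith)]
    rcases le_total s 2 with h2 | h2
    · simp only [m1 h, m2 h2, m2 (show s ≤ 3 by linarith)]
      have : 0 ≤ s - 1 := by linarith
      ring_nf at this ⊢
      have := pow_nonneg this 3
      nlinarith
    rcases le_total s 3 with h3 | h3
    · simp only [m1 h, m1 h2, m2 h3]
      nlinarith [mul_nonneg (sub_nonneg.2 h2) (sub_nonneg.2 h3),
        mul_nonneg (mul_nonneg (sub_nonneg.2 h2) (sub_nonneg.2 h3)) (sub_nonneg.2 h)]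
    · simp only [m1 h, m1 h2, m1 h3]
      nlinarith
  · intro s hs
    simp only [m1 hs, m1 (show 2 ≤ s by linarith), m1 (show 1 ≤ s by linarith)]
    ring
  · intro s
    rcases le_total s 1 with h | h
    · simp [m2 h, m2 (show s ≤ 2 by linarith), m2 (show s ≤ 3 by linarith)]
    rcases le_total s 2 with h2 | h2
    · simp only [m1 h, m2 h2, m2 (show s ≤ 3 by linarith)]
      nlinarith
    rcases le_total s 3 with h3 | h3
    · simp only [m1 h, m1 h2, m2 h3]
      nlinarith [mul_nonneg (sub_nonneg.2 h2) (sub_nonneg.2 h3)]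
    · simp only [m1 h, m1 h2, m1 h3]
      nlinarith
  · intro s
    rcases le_total s 1 with h | h
    · simp [m2 h, m2 (show s ≤ 2 by linarith), m2 (show s ≤ 3 by linarith)]
    rcases le_total s 2 with h2 | h2
    · simp only [m1 h, m2 h2, m2 (show s ≤ 3 by linarith)]
      nlinarith
    rcases le_total s 3 with h3 | h3
    · simp only [m1 h, m1 h2, m2 h3]
      nlinarith [sq_nonneg (s - 3)]
    · simp only [m1 h, m1 h2, m1 h3]
      nlinarith
  · intro s
    rcases le_total s 1 with h | h
    · simp [m2 h, m2 (show s ≤ 2 by linarith), m2 (show s ≤ 3 by linarith)]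
    rcases le_total s 2 with h2 | h2
    · simp only [m1 h, m2 h2, m2 (show s ≤ 3 by linarith)]
      linarith
    rcases le_total s 3 with h3 | h3
    · simp only [m1 h, m1 h2, m2 h3]
      linarith
    · simp only [m1 h, m1 h2, m1 h3]
      linarith
  · intro s hs
    simp only [m1 hs, m1 (show 2 ≤ s by linarith), m1 (show 1 ≤ s by linarith)]
    ring

/-- A `C²` transition from `0` to `1` on `[τ, 2δ]` which is concave beyond `3τ`. -/
lemma exists_concave_cutoff {τ δ : ℝ} (hτ : 0 < τ) (hδ : 3 * τ ≤ δ) :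
    ∃ θ θ' θ'' : ℝ → ℝ, (∀ s, HasDerivAt θ (θ' s) s) ∧ (∀ s, HasDerivAt θ' (θ'' s) s) ∧
      Continuous θ'' ∧ (∀ s ≤ τ, θ s = 0) ∧ (∀ s, 0 ≤ θ s) ∧ (∀ s, θ s ≤ 1) ∧
      (∀ s, 2 * δ ≤ s → θ s = 1) ∧ (∀ s, |θ' s| ≤ 3 / δ) ∧ (∀ s, 2 * δ ≤ s → θ' s = 0) ∧
      (∀ s, θ'' s ≤ 3 / (δ * τ)) ∧ (∀ s, 3 * τ ≤ s → θ'' s ≤ 0) := by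
  obtain ⟨c, c', c'', hc, hc', hcont, c0, cpos, c3, c'0, c'1, c''1, c''3⟩ := exists_convex_ramp
  have hδ0 : 0 < δ := by linarith
  -- `κ` vanishes up to `τ`, equals `(s - 2τ)/δ` from `3τ` on, and is at least `1` from `2δ` on. The
  -- profile is `θ = 1 - (1 - κ)₊³`, a concave increasing function of `κ`: it is concave where `κ`
  -- is affine, and elsewhere `θ''` is limited by the bound `1/(δτ)` on `κ''`.
  set κ : ℝ → ℝ := fun s => τ * c (s / τ) / δ
  have hκ0 : ∀ s, 0 ≤ κ s := fun s => by have := cpos (s / τ); positivity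
  have hκ : ∀ s, HasDerivAt κ (c' (s / τ) / δ) s := fun s => by
    have h1 : HasDerivAt (fun t => c (t / τ)) (c' (s / τ) * (1 / τ)) s :=
      (hc (s / τ)).comp s ((hasDerivAt_id s).div_const τ)
    refine ((h1.const_mul τ).div_const δ).congr_deriv ?_
    field_simp
  have hκ' : ∀ s, HasDerivAt (fun s => c' (s / τ) / δ) (c'' (s / τ) / (δ * τ)) s := fun s => by
    have h1 : HasDerivAt (fun t => c' (t / τ)) (c'' (s / τ) * (1 / τ)) s :=
      (hc' (s / τ)).comp s ((hasDerivAt_id s).div_const τ)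
    refine (h1.div_const δ).congr_deriv ?_
    field_simp
  have hκc : Continuous κ := continuous_iff_continuousAt.2 fun s => (hκ s).continuousAt
  have hκc' : Continuous fun s => c' (s / τ) / δ :=
    continuous_iff_continuousAt.2 fun s => (hκ' s).continuousAt
  have hd : ∀ (n : ℕ) (s : ℝ), HasDerivAt (fun t : ℝ => max (1 - κ t) 0 ^ (n + 2))
      ((n + 2) * max (1 - κ s) 0 ^ (n + 1) * -(c' (s / τ) / δ)) s := fun n s =>
    HasDerivAt.comp (h₂ := fun t : ℝ => max t 0 ^ (n + 2)) s
      (hasDerivAt_max_zero_pow n (1 - κ s)) ((hκ s).const_sub 1)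
  have hm0 : ∀ s, 0 ≤ max (1 - κ s) 0 := fun s => le_max_right _ _
  have hm1 : ∀ s, max (1 - κ s) 0 ≤ 1 := fun s => max_le (by linarith [hκ0 s]) zero_le_one
  have hone : ∀ s, 2 * δ ≤ s → max (1 - κ s) 0 = 0 := fun s hs => by
    have h3 : 3 ≤ s / τ := (le_div_iff₀ hτ).2 (by linarith)
    have : κ s = (s - 2 * τ) / δ := by
      simp only [κ, c3 _ h3]
      field_simp
    rw [this]
    have : 1 ≤ (s - 2 * τ) / δ := (le_div_iff₀ hδ0).2 (by linarith)
    exact max_eq_right (by linarith)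
  have hm2 : ∀ s, max (1 - κ s) 0 ^ 2 ≤ 1 := fun s => pow_le_one₀ (hm0 s) (hm1 s)
  refine ⟨fun s => 1 - max (1 - κ s) 0 ^ 3,
    fun s => 3 * max (1 - κ s) 0 ^ 2 * (c' (s / τ) / δ),
    fun s => 3 * max (1 - κ s) 0 ^ 2 * (c'' (s / τ) / (δ * τ))
      - 6 * max (1 - κ s) 0 * (c' (s / τ) / δ) ^ 2, ?_, ?_, ?_, ?_, ?_, ?_, ?_, ?_, ?_, ?_, ?_⟩
  · intro s
    refine ((hd 1 s).const_sub 1).congr_deriv ?_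
    norm_num
  · intro s
    refine (((hd 0 s).const_mul 3).mul (hκ' s)).congr_deriv ?_
    norm_num
    ring
  · fun_prop
  · intro s hs
    have : κ s = 0 := by simp [κ, c0 _ ((div_le_one hτ).2 hs)]
    simp [this]
  · intro s
    have := pow_le_one₀ (n := 3) (hm0 s) (hm1 s)
    linarith
  · intro s
    have := pow_nonneg (hm0 s) 3
    linarith
  · intro s hs
    simp [hone s hs]
  · intro s
    have h1 : c' (s / τ) / δ ≤ 1 / δ := div_le_div_of_nonneg_right (c'1 _) hδ0.le
    have h2 : 0 ≤ c' (s / τ) / δ := div_nonneg (c'0 _) hδ0.le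
    rw [abs_of_nonneg (by positivity)]
    calc 3 * max (1 - κ s) 0 ^ 2 * (c' (s / τ) / δ) ≤ 3 * 1 * (1 / δ) := by
          have := hm2 s
          gcongr
      _ = 3 / δ := by ring
  · intro s hs
    simp [hone s hs]
  · intro s
    have h0 : 0 ≤ 6 * max (1 - κ s) 0 * (c' (s / τ) / δ) ^ 2 :=
      mul_nonneg (mul_nonneg (by norm_num) (hm0 s)) (sq_nonneg _)
    have h1 : c'' (s / τ) / (δ * τ) ≤ 1 / (δ * τ) :=
      div_le_div_of_nonneg_right (c''1 _) (by positivity)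
    have h2 : 3 * max (1 - κ s) 0 ^ 2 * (c'' (s / τ) / (δ * τ)) ≤ 3 * 1 * (1 / (δ * τ)) := by
      have a := hm2 s
      refine (mul_le_mul_of_nonneg_left h1 (by positivity)).trans
        (mul_le_mul_of_nonneg_right ?_ (by positivity))
      linarith
    have h3 : 3 * 1 * (1 / (δ * τ)) = 3 / (δ * τ) := by ring
    linarith
  · intro s hs
    have h3 := c''3 _ ((le_div_iff₀ hτ).2 hs)
    have h0 : 0 ≤ 6 * max (1 - κ s) 0 * (c' (s / τ) / δ) ^ 2 :=
      mul_nonneg (mul_nonneg (by norm_num) (hm0 s)) (sq_nonneg _)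
    simp only [h3, zero_div, mul_zero]
    linarith

end Cutoff

/-! ### Smallness of `W^{1,q}_0` functions in boundary collars. -/

section Collar

open Filter Topology

variable {d : ℕ}

local notation "𝔼" => EuclideanSpace ℝ (Fin d)

/-- The height of a point above the graph of `γ` in the direction `e`. -/
noncomputable def graphHeight (e : 𝔼) (γ : 𝔼 → ℝ) (x : 𝔼) : ℝ :=
  inner ℝ e x - γ (x - (inner ℝ e x : ℝ) • e)

/-- Motion along `e` does not change the horizontal part, so the vertical line down from `x` meets
the graph exactly after length `graphHeight e γ x`. -/
lemma graphHeight_sub_smul {e : 𝔼} (he : ‖e‖ = 1) (γ : 𝔼 → ℝ) (x : 𝔼) (s : ℝ) :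
    graphHeight e γ (x - s • e) = graphHeight e γ x - s := by
  have h : inner ℝ e (x - s • e) = inner ℝ e x - s := by
    rw [inner_sub_right, inner_smul_right, real_inner_self_eq_norm_sq, he]
    simp
  have h2 : x - s • e - (inner ℝ e x - s) • e = x - (inner ℝ e x : ℝ) • e := by
    rw [sub_smul]
    abel
  simp only [graphHeight, h, h2]
  ring

lemma contDiff_graphHeight {n : WithTop ℕ∞} (e : 𝔼) {γ : 𝔼 → ℝ} (hγ : ContDiff ℝ n γ) :
    ContDiff ℝ n (graphHeight e γ) := by
  have h : ContDiff ℝ n fun x : 𝔼 => (inner ℝ e x : ℝ) := contDiff_const.inner ℝ contDiff_id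
  exact h.sub (hγ.comp (contDiff_id.sub (h.smul contDiff_const)))

/-- The part of the ball of radius `r` where the height is between `0` and `δ`. -/
def collar (e : 𝔼) (γ : 𝔼 → ℝ) (x₀ : 𝔼) (r δ : ℝ) : Set 𝔼 :=
  Metric.ball x₀ r ∩ {x | 0 < graphHeight e γ x ∧ graphHeight e γ x < δ}

lemma measurableSet_collar (e : 𝔼) {γ : 𝔼 → ℝ} (hγ : Continuous γ) (x₀ : 𝔼) (r δ : ℝ) :
    MeasurableSet (collar e γ x₀ r δ) := by
  have h : Continuous (graphHeight e γ) := (contDiff_graphHeight (n := 0) e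
    (contDiff_zero.2 hγ)).continuous
  exact Metric.isOpen_ball.measurableSet.inter
    ((isOpen_lt continuous_const h).inter (isOpen_lt h continuous_const)).measurableSet

/-- A Poincaré inequality on a thin collar of the boundary, for functions vanishing outside. -/
lemma lintegral_collar_le {Ω : Set 𝔼} {x₀ e : 𝔼} {r : ℝ} {γ : 𝔼 → ℝ} (he : ‖e‖ = 1)
    (hγ : Continuous γ)
    (hΩ : ∀ x ∈ Metric.ball x₀ r, x ∈ Ω ↔ 0 < graphHeight e γ x) {φ : 𝔼 → ℝ}
    (hφ : ContDiff ℝ 1 φ) (hs : tsupport φ ⊆ Ω) {δ : ℝ} (hδ : δ ≤ r / 2) :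
    ∫⁻ x in collar e γ x₀ (r / 2) δ, ‖φ x‖ₑ
      ≤ ENNReal.ofReal δ * ∫⁻ x in collar e γ x₀ r δ, ‖fderiv ℝ φ x‖ₑ := by
  set S := collar e γ x₀ (r / 2) δ
  set T := collar e γ x₀ r δ
  have hS : MeasurableSet S := measurableSet_collar e hγ _ _ _
  have hT : MeasurableSet T := measurableSet_collar e hγ _ _ _
  have hfd : Continuous (fderiv ℝ φ) := hφ.continuous_fderiv one_ne_zero
  -- Cutting off to `T` makes the integrand a function on the whole space, so that translation
  -- invariance applies after exchanging integrals.
  set G : 𝔼 → ℝ≥0∞ := T.indicator fun x => ‖fderiv ℝ φ x‖ₑ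
  have hG : Measurable G := (hfd.enorm.measurable).indicator hT
  -- Fundamental theorem of calculus along the vertical segment down to the graph, whose endpoint
  -- lies outside `Ω`, so that `φ` vanishes there. The segment has length below `δ ≤ r / 2`, hence
  -- stays in the ball of radius `r`.
  have hpt : ∀ x ∈ S, ‖φ x‖ₑ ≤ ∫⁻ s in Set.Ioc 0 δ, G (x - s • e) := by
    intro x hx
    obtain ⟨hxB, hx0, hxδ⟩ := hx
    set ρ := graphHeight e γ x
    have hball : ∀ s, 0 ≤ s → s ≤ ρ → x - s • e ∈ Metric.ball x₀ r := fun s hs0 hs => by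
      have h1 : dist (x - s • e) x = s := by
        simp [norm_smul, he, abs_of_nonneg hs0]
      have h2 := dist_triangle (x - s • e) x x₀
      have h3 : dist x x₀ < r / 2 := hxB
      rw [Metric.mem_ball]
      linarith
    have hzero : φ (x - ρ • e) = 0 := by
      refine image_eq_zero_of_notMem_tsupport fun h => ?_
      have := (hΩ _ (hball ρ hx0.le le_rfl)).1 (hs h)
      rw [graphHeight_sub_smul he] at this
      simp [ρ] at this
    have hder : ∀ s : ℝ, HasDerivAt (fun s : ℝ => φ (x - s • e))
        (fderiv ℝ φ (x - s • e) (-e)) s := fun s => by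
      have h1 : HasDerivAt (fun s : ℝ => x - s • e) (-e) s := by
        simpa using ((hasDerivAt_id s).smul_const e).const_sub x
      exact ((hφ.differentiable one_ne_zero (x - s • e)).hasFDerivAt).comp_hasDerivAt s h1
    have hcont : Continuous fun s : ℝ => fderiv ℝ φ (x - s • e) (-e) :=
      (hfd.comp (by fun_prop)).clm_apply continuous_const
    have hftc := intervalIntegral.integral_eq_sub_of_hasDerivAt (a := 0) (b := ρ)
      (fun s _ => hder s) (hcont.intervalIntegrable _ _)
    rw [hzero, zero_smul, sub_zero, zero_sub, intervalIntegral.integral_of_le hx0.le] at hftc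
    calc ‖φ x‖ₑ = ‖∫ s in Set.Ioc 0 ρ, fderiv ℝ φ (x - s • e) (-e)‖ₑ := by rw [hftc, enorm_neg]
      _ ≤ ∫⁻ s in Set.Ioc 0 ρ, ‖fderiv ℝ φ (x - s • e) (-e)‖ₑ :=
          enorm_integral_le_lintegral_enorm _
      _ = ∫⁻ s in Set.Ioo 0 ρ, ‖fderiv ℝ φ (x - s • e) (-e)‖ₑ := by
          rw [restrict_Ioo_eq_restrict_Ioc]
      _ ≤ ∫⁻ s in Set.Ioo 0 ρ, G (x - s • e) := by
          refine setLIntegral_mono (hG.comp (by fun_prop)) fun s hs => ?_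
          have hmem : x - s • e ∈ T := by
            refine ⟨hball s hs.1.le hs.2.le, ?_⟩
            rw [Set.mem_ofPred_eq, graphHeight_sub_smul he]
            exact ⟨by linarith [hs.2], by linarith [hs.1]⟩
          simp only [G, Set.indicator_of_mem hmem]
          refine (ContinuousLinearMap.le_opENorm _ _).trans_eq ?_
          rw [enorm_neg, ← ofReal_norm e, he]
          simp
      _ ≤ ∫⁻ s in Set.Ioc 0 δ, G (x - s • e) :=
          lintegral_mono_set fun s hs => ⟨hs.1, (hs.2.trans hxδ).le⟩
  calc ∫⁻ x in S, ‖φ x‖ₑ ≤ ∫⁻ x in S, ∫⁻ s in Set.Ioc 0 δ, G (x - s • e) :=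
        setLIntegral_mono' hS hpt
    _ ≤ ∫⁻ x, ∫⁻ s in Set.Ioc 0 δ, G (x - s • e) := setLIntegral_le_lintegral _ _
    _ = ∫⁻ s in Set.Ioc 0 δ, ∫⁻ x, G (x - s • e) := by
        refine lintegral_lintegral_swap ?_
        exact (hG.comp (by fun_prop : Measurable fun p : 𝔼 × ℝ => p.1 - p.2 • e)).aemeasurable
    _ = ∫⁻ _ in Set.Ioc 0 δ, ∫⁻ x, G x := by
        refine lintegral_congr fun s => ?_
        exact lintegral_sub_right_eq_self G (s • e)
    _ = ENNReal.ofReal δ * ∫⁻ x in T, ‖fderiv ℝ φ x‖ₑ := by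
        rw [lintegral_const, Measure.restrict_apply_univ, Real.volume_Ioc, sub_zero, mul_comm,
          lintegral_indicator hT]

lemma enorm_gradient (φ : 𝔼 → ℝ) (x : 𝔼) : ‖gradient φ x‖ₑ = ‖fderiv ℝ φ x‖ₑ := by
  rw [← ofReal_norm, ← ofReal_norm, gradient, LinearIsometryEquiv.norm_map]

/-- Functions in `W^{1,q}_0` are limits in `W^{1,1}` of compactly supported `C¹` functions. -/
lemma MemW10.exists_approx {Ω : Set 𝔼} {q : ℝ≥0∞} {u : 𝔼 → ℝ} (hq : 1 ≤ q)
    (hfin : volume Ω ≠ ⊤) (h : MemW10 Ω q u) :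
    IntegrableOn u Ω ∧ ∃ Du : 𝔼 → 𝔼, IntegrableOn Du Ω ∧ ∀ ε : ℝ≥0∞, 0 < ε →
      ∃ φ : 𝔼 → ℝ, ContDiff ℝ 1 φ ∧ tsupport φ ⊆ Ω ∧
        ∫⁻ x in Ω, ‖u x - φ x‖ₑ ≤ ε ∧ ∫⁻ x in Ω, ‖Du x - gradient φ x‖ₑ ≤ ε := by
  obtain ⟨hu, Du, -, hDu, happ⟩ := h
  have : IsFiniteMeasure (volume.restrict Ω) := ⟨by simpa using hfin.lt_top⟩
  refine ⟨hu.integrable hq, Du, hDu.integrable hq, fun ε hε => ?_⟩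
  -- The Hölder factor between the `L¹` and `L^q` norms. Below, `A + 1` replaces it in the
  -- denominator to avoid dividing by zero.
  set A : ℝ≥0∞ := (volume.restrict Ω) Set.univ ^ (1 / (1 : ℝ≥0∞).toReal - 1 / q.toReal)
  have hA : A ≠ ⊤ := by
    refine ENNReal.rpow_ne_top_of_nonneg ?_ (measure_ne_top _ _)
    rcases eq_or_ne q ⊤ with rfl | hq'
    · simp
    · have : 1 ≤ q.toReal := by
        simpa using (ENNReal.toReal_le_toReal ENNReal.one_ne_top hq').2 hq
      rw [ENNReal.toReal_one, sub_nonneg]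
      exact one_div_le_one_div_of_le one_pos this
  obtain ⟨φ, hφ, hφc, hφs, h1, h2⟩ := happ (ε / (A + 1))
    (ENNReal.div_pos hε.ne' (by simp [hA]))
  have hgr : Continuous (gradient φ) := by
    have := hφ.continuous_fderiv one_ne_zero
    exact (InnerProductSpace.toDual ℝ 𝔼).symm.continuous.comp this
  have hle : ε / (A + 1) * A ≤ ε := by
    calc ε / (A + 1) * A ≤ ε / (A + 1) * (A + 1) := by gcongr; exact le_self_add
      _ ≤ ε := by rw [mul_comm]; exact ENNReal.mul_div_le
  refine ⟨φ, hφ, hφs, ?_, ?_⟩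
  · rw [← eLpNorm_one_eq_lintegral_enorm]
    refine (eLpNorm_le_eLpNorm_mul_rpow_measure_univ hq
      (hu.1.sub hφ.continuous.aestronglyMeasurable)).trans ?_
    exact (mul_le_mul_left h1.le _).trans hle
  · rw [← eLpNorm_one_eq_lintegral_enorm]
    refine (eLpNorm_le_eLpNorm_mul_rpow_measure_univ hq
      (hDu.1.sub hgr.aestronglyMeasurable)).trans ?_
    exact (mul_le_mul_left h2.le _).trans hle

/-- The Poincaré inequality for test functions survives `L¹` limits of the function and its
gradient. `Du` is fixed before the chart and the width, so its integral over shrinking collars can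
be sent to zero. -/
lemma MemW10.lintegral_collar_le {Ω : Set 𝔼} {q : ℝ≥0∞} {u : 𝔼 → ℝ} (hq : 1 ≤ q)
    (hfin : volume Ω ≠ ⊤) (h : MemW10 Ω q u) : ∃ Du : 𝔼 → 𝔼, IntegrableOn Du Ω ∧
      ∀ {x₀ e : 𝔼} {r : ℝ} {γ : 𝔼 → ℝ}, ‖e‖ = 1 → Continuous γ →
      (∀ x ∈ Metric.ball x₀ r, x ∈ Ω ↔ 0 < graphHeight e γ x) → ∀ {δ : ℝ}, δ ≤ r / 2 →
      ∫⁻ x in collar e γ x₀ (r / 2) δ, ‖u x‖ₑ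
        ≤ ENNReal.ofReal δ * ∫⁻ x in collar e γ x₀ r δ, ‖Du x‖ₑ := by
  obtain ⟨hu, Du, hDu, happ⟩ := h.exists_approx hq hfin
  refine ⟨Du, hDu, fun {x₀ e r γ} he hγ hΩ δ hδ => ?_⟩
  have hTΩ : collar e γ x₀ r δ ⊆ Ω := fun x hx => (hΩ x hx.1).2 hx.2.1
  have hSΩ : collar e γ x₀ (r / 2) δ ⊆ Ω := fun x hx => by
    have hr : 0 < r / 2 := Metric.pos_of_mem_ball hx.1
    exact hTΩ ⟨Metric.ball_subset_ball (by linarith) hx.1, hx.2⟩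
  set S := collar e γ x₀ (r / 2) δ
  set T := collar e γ x₀ r δ
  have key : ∀ ε : ℝ≥0∞, 0 < ε → ∫⁻ x in S, ‖u x‖ₑ
      ≤ ENNReal.ofReal δ * (∫⁻ x in T, ‖Du x‖ₑ) + (ENNReal.ofReal δ + 1) * ε := by
    intro ε hε
    obtain ⟨φ, hφ, hs, h1, h2⟩ := happ ε hε
    have hfd : Continuous (fderiv ℝ φ) := hφ.continuous_fderiv one_ne_zero
    have hgr : Continuous (gradient φ) := (InnerProductSpace.toDual ℝ 𝔼).symm.continuous.comp hfd
    have a1 : ∫⁻ x in S, ‖u x‖ₑ ≤ ε + ∫⁻ x in S, ‖φ x‖ₑ := by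
      calc ∫⁻ x in S, ‖u x‖ₑ ≤ ∫⁻ x in S, (‖u x - φ x‖ₑ + ‖φ x‖ₑ) :=
            lintegral_mono fun x => by simpa using enorm_add_le (u x - φ x) (φ x)
        _ = (∫⁻ x in S, ‖u x - φ x‖ₑ) + ∫⁻ x in S, ‖φ x‖ₑ :=
            lintegral_add_right _ hφ.continuous.enorm.measurable
        _ ≤ ε + ∫⁻ x in S, ‖φ x‖ₑ := by
            gcongr
            exact (lintegral_mono_set hSΩ).trans h1
    have a2 : ∫⁻ x in T, ‖fderiv ℝ φ x‖ₑ ≤ (∫⁻ x in T, ‖Du x‖ₑ) + ε := by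
      simp only [← enorm_gradient]
      have hm : AEMeasurable (fun x => ‖Du x‖ₑ) (volume.restrict T) :=
        (hDu.mono_set hTΩ).aestronglyMeasurable.enorm
      calc ∫⁻ x in T, ‖gradient φ x‖ₑ ≤ ∫⁻ x in T, (‖Du x‖ₑ + ‖Du x - gradient φ x‖ₑ) :=
            lintegral_mono fun x => by
              simpa using enorm_sub_le (a := Du x) (b := Du x - gradient φ x)
        _ = (∫⁻ x in T, ‖Du x‖ₑ) + ∫⁻ x in T, ‖Du x - gradient φ x‖ₑ := lintegral_add_left' hm _
        _ ≤ (∫⁻ x in T, ‖Du x‖ₑ) + ε := by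
            gcongr
            exact (lintegral_mono_set hTΩ).trans h2
    calc ∫⁻ x in S, ‖u x‖ₑ ≤ ε + ENNReal.ofReal δ * ((∫⁻ x in T, ‖Du x‖ₑ) + ε) := by
          refine a1.trans ?_
          gcongr
          refine (_root_.lintegral_collar_le he hγ hΩ hφ hs hδ).trans ?_
          gcongr
      _ = _ := by ring
  refine ENNReal.le_of_forall_pos_le_add fun ε hε _ => ?_
  have hc : (ENNReal.ofReal δ + 1) ≠ ⊤ := by simp
  refine (key (ε / (ENNReal.ofReal δ + 1)) (ENNReal.div_pos (by simpa using hε.ne') hc)).trans ?_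
  gcongr
  exact ENNReal.mul_div_le

/-- The `L¹` norm on a collar of width `δ` of a function in `W^{1,q}_0` is `o(δ)`. -/
lemma MemW10.exists_collar_bound {Ω : Set 𝔼} {q : ℝ≥0∞} {u : 𝔼 → ℝ} (hq : 1 ≤ q)
    (hfin : volume Ω ≠ ⊤) (h : MemW10 Ω q u) {x₀ e : 𝔼} {r : ℝ} {γ : 𝔼 → ℝ} (hr : 0 < r)
    (he : ‖e‖ = 1) (hγ : Continuous γ)
    (hΩ : ∀ x ∈ Metric.ball x₀ r, x ∈ Ω ↔ 0 < graphHeight e γ x) {ε : ℝ} (hε : 0 < ε) :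
    ∃ δ₀ > 0, ∀ δ, 0 < δ → δ ≤ δ₀ → ∫ x in collar e γ x₀ (r / 2) δ, |u x| ≤ δ * ε := by
  obtain ⟨hu, -⟩ := h.exists_approx hq hfin
  obtain ⟨Du, hDu, hle⟩ := h.lintegral_collar_le hq hfin
  have hTΩ : ∀ δ, collar e γ x₀ r δ ⊆ Ω := fun δ x hx => (hΩ x hx.1).2 hx.2.1
  have hSΩ : ∀ δ, collar e γ x₀ (r / 2) δ ⊆ Ω := fun δ x hx =>
    hTΩ δ ⟨Metric.ball_subset_ball (by linarith) hx.1, hx.2⟩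
  have hmono : ∀ {a b : ℝ}, a ≤ b → collar e γ x₀ r a ⊆ collar e γ x₀ r b := fun hab x hx =>
    ⟨hx.1, hx.2.1, hx.2.2.trans_le hab⟩
  -- The collars decrease to the empty set because the height is strictly positive on them. This
  -- upgrades the Poincaré bound from `O(δ)` to `o(δ)`.
  have hlim : Tendsto (fun n : ℕ => ∫ x in collar e γ x₀ r (1 / ((n : ℝ) + 1)), ‖Du x‖) atTop
      (𝓝 0) := by
    have h1 := tendsto_setIntegral_of_antitone (μ := volume) (f := fun x => ‖Du x‖)
      (s := fun n : ℕ => collar e γ x₀ r (1 / ((n : ℝ) + 1)))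
      (fun n => measurableSet_collar e hγ _ _ _)
      (fun m n hmn => hmono (one_div_le_one_div_of_le (by positivity) (by
        have : (m : ℝ) ≤ n := by exact_mod_cast hmn
        linarith))) ⟨0, (hDu.mono_set (hTΩ _)).norm⟩
    have h2 : ⋂ n : ℕ, collar e γ x₀ r (1 / ((n : ℝ) + 1)) = ∅ := by
      refine Set.eq_empty_of_forall_notMem fun x hx => ?_
      rw [Set.mem_iInter] at hx
      obtain ⟨n, hn⟩ := exists_nat_one_div_lt (hx 0).2.1
      exact lt_asymm hn (hx n).2.2
    rwa [h2, setIntegral_empty] at h1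
  obtain ⟨n, hn⟩ := (hlim.eventually (gt_mem_nhds hε)).exists
  refine ⟨min (r / 2) (1 / ((n : ℝ) + 1)), lt_min (by positivity) (by positivity),
    fun δ hδ0 hδ => ?_⟩
  have hn' : ∫ x in collar e γ x₀ r δ, ‖Du x‖ ≤ ε :=
    (setIntegral_mono_set ((hDu.mono_set (hTΩ _)).norm) (ae_of_all _ fun x => norm_nonneg _)
      (hmono (hδ.trans (min_le_right _ _))).eventuallyLE).trans hn.le
  have h1 := hle he hγ hΩ (hδ.trans (min_le_left _ _))
  rw [← ofReal_integral_norm_eq_lintegral_enorm (hDu.mono_set (hTΩ _)),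
    ← ofReal_integral_norm_eq_lintegral_enorm (hu.mono_set (hSΩ _)),
    ← ENNReal.ofReal_mul hδ0.le] at h1
  have h2 := (ENNReal.ofReal_le_ofReal_iff (mul_nonneg hδ0.le
    (integral_nonneg fun x => norm_nonneg _))).1 h1
  exact h2.trans (mul_le_mul_of_nonneg_left hn' hδ0.le)

end Collar

/-! ### Extension by zero is a subsolution across the boundary. -/

section Boundary

open Filter Topology

variable {d : ℕ}

local notation "𝔼" => EuclideanSpace ℝ (Fin d)

/-- A subsolution tested with compactly supported functions in `Ω`, and small in `L¹` near a
boundary patch, is a subsolution across that patch. -/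
lemma subsolution_across_boundary {Ω : Set 𝔼} {x₀ e : 𝔼} {r : ℝ} {γ : 𝔼 → ℝ}
    (hγ : ContDiff ℝ 2 γ)
    (hΩ : ∀ x ∈ Metric.ball x₀ (r / 2), x ∈ Ω ↔ 0 < graphHeight e γ x)
    {lam : ℝ} {p g : 𝔼 → ℝ} (hp : Integrable p) (hg : Integrable g) (hp0 : ∀ x, 0 ≤ p x)
    (hpΩ : ∀ x ∉ Ω, p x = 0) (hgΩ : ∀ x ∉ Ω, g x = 0)
    (hK : ∀ η : 𝔼 → ℝ, ContDiff ℝ 2 η → HasCompactSupport η → tsupport η ⊆ Ω → (∀ x, 0 ≤ η x) →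
      ∫ x, (lam * p x - g x) * η x ≤ ∫ x, p x * laplace η x)
    (hcol : ∀ ε > 0, ∃ δ₀ > 0, ∀ δ, 0 < δ → δ ≤ δ₀ →
      ∫ x in collar e γ x₀ (r / 2) δ, p x ≤ δ * ε)
    {ψ : 𝔼 → ℝ} (hψ : ContDiff ℝ 2 ψ) (hψc : HasCompactSupport ψ)
    (hψB : tsupport ψ ⊆ Metric.ball x₀ (r / 2)) (hψ0 : ∀ x, 0 ≤ ψ x) :
    ∫ x, (lam * p x - g x) * ψ x ≤ ∫ x, p x * laplace ψ x := by
  set ρ : 𝔼 → ℝ := graphHeight e γ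
  have hρ : ContDiff ℝ 2 ρ := contDiff_graphHeight e hγ
  -- With these, the Laplacian of `ψ θ(ρ)` is `θ(ρ) Δψ + θ'(ρ) A + θ''(ρ) B`. Only an upper bound is
  -- needed, so `B ≥ 0` makes the concave range of `θ` harmless.
  set A : 𝔼 → ℝ := fun x => 2 * (∑ i, pderiv i ψ x * pderiv i ρ x) + ψ x * laplace ρ x
  set B : 𝔼 → ℝ := fun x => ψ x * ∑ i, pderiv i ρ x ^ 2
  have hpc := fun i => (hψ.pderiv (m := 1) le_rfl i).continuous
  have hpr := fun i => (hρ.pderiv (m := 1) le_rfl i).continuous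
  have hA : Continuous A := (continuous_const.mul (continuous_finsetSum _ fun i _ =>
    (hpc i).mul (hpr i))).add (hψ.continuous.mul hρ.continuous_laplace)
  have hB : Continuous B := hψ.continuous.mul (continuous_finsetSum _ fun i _ => (hpr i).pow 2)
  have hA0 : ∀ x ∉ tsupport ψ, A x = 0 := fun x hx => by
    have h1 : ∀ i, pderiv i ψ x = 0 := fun i =>
      image_eq_zero_of_notMem_tsupport fun h => hx (tsupport_pderiv_subset ψ i h)
    simp [A, h1, image_eq_zero_of_notMem_tsupport hx]
  have hB0 : ∀ x ∉ tsupport ψ, B x = 0 := fun x hx => by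
    simp [B, image_eq_zero_of_notMem_tsupport hx]
  have hBpos : ∀ x, 0 ≤ B x := fun x =>
    mul_nonneg (hψ0 x) (Finset.sum_nonneg fun i _ => sq_nonneg _)
  obtain ⟨CA, hCA⟩ := hA.bounded_above_of_compact_support (HasCompactSupport.intro hψc hA0)
  obtain ⟨CB, hCB⟩ := hB.bounded_above_of_compact_support (HasCompactSupport.intro hψc hB0)
  obtain ⟨CL, hCL⟩ := hψ.continuous_laplace.bounded_above_of_compact_support hψc.laplace
  obtain ⟨Cψ, hCψ⟩ := hψ.continuous.bounded_above_of_compact_support hψc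
  have hCA0 : 0 ≤ CA := (norm_nonneg _).trans (hCA 0)
  have hCB0 : 0 ≤ CB := (norm_nonneg _).trans (hCB 0)
  have hL0 : ∀ x ∉ tsupport ψ, laplace ψ x = 0 := fun x => laplace_eq_zero_of_notMem_tsupport
  have hmeas : ∀ δ, MeasurableSet (collar e γ x₀ (r / 2) δ) := fun δ =>
    measurableSet_collar e hγ.continuous _ _ _
  have hcontθ : ∀ {θ : ℝ → ℝ}, Continuous θ → Continuous fun x => θ (ρ x) := fun h =>
    h.comp hρ.continuous
  have key : ∀ n : ℕ, ∃ θ : ℝ → ℝ, Continuous θ ∧ (∀ s, 0 ≤ θ s) ∧ (∀ s, θ s ≤ 1) ∧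
      (∀ s, 2 * (1 / ((n : ℝ) + 1)) ≤ s → θ s = 1) ∧
      ∫ x, (lam * p x - g x) * (ψ x * θ (ρ x))
        ≤ (∫ x, p x * (laplace ψ x * θ (ρ x))) + (6 * CA + 9 * CB) * (1 / ((n : ℝ) + 1)) := by
    intro n
    set ε : ℝ := 1 / ((n : ℝ) + 1)
    have hε : 0 < ε := by positivity
    obtain ⟨δ₀, hδ₀, hcol1⟩ := hcol ε hε
    set δ := min (δ₀ / 2) ε
    have hδ : 0 < δ := lt_min (by positivity) hε
    -- `τ` is chosen after `δ`, with tolerance `δ * ε`: the integral of `p` over the collar of width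
    -- `3τ` is then at most `3τδε`, which absorbs the factor `3/(δτ)` bounding `θ''`. With a single
    -- width the second derivative would be of order `δ⁻²`, too large for an `o(δ)` bound.
    obtain ⟨τ₀, hτ₀, hcol2⟩ := hcol (δ * ε) (by positivity)
    set τ := min (τ₀ / 3) (δ / 3)
    have hτ : 0 < τ := lt_min (by positivity) (by positivity)
    have hτδ : 3 * τ ≤ δ := by linarith [min_le_right (τ₀ / 3) (δ / 3)]
    have hc1 := hcol1 (2 * δ) (by positivity) (by linarith [min_le_left (δ₀ / 2) ε])
    have hc2 := hcol2 (3 * τ) (by positivity) (by linarith [min_le_left (τ₀ / 3) (δ / 3)])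
    obtain ⟨θ, θ', θ'', hd, hd', hcont, h0, hθ0, hθ1, h2, hθ', hθ'2, hθ'', hθ''3⟩ :=
      exists_concave_cutoff hτ hτδ
    have hθC : ContDiff ℝ 2 θ := contDiff_two_of_hasDerivAt hd hd' hcont
    refine ⟨θ, hθC.continuous, hθ0, hθ1, fun s hs => h2 s (le_trans ?_ hs), ?_⟩
    · linarith [min_le_right (δ₀ / 2) ε]
    set η : 𝔼 → ℝ := fun x => ψ x * θ (ρ x)
    have hη : ContDiff ℝ 2 η := hψ.mul (hθC.comp hρ)
    have hηc : HasCompactSupport η := hψc.mul_right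
    have hηs : tsupport η ⊆ Ω := by
      have hsub : tsupport η ⊆ tsupport ψ ∩ {x | τ ≤ ρ x} := by
        refine closure_minimal (fun x hx => ⟨subset_tsupport _ ?_, ?_⟩)
          ((isClosed_tsupport _).inter (isClosed_le continuous_const hρ.continuous))
        · exact fun h => hx (by simp [η, h])
        · by_contra hlt
          exact hx (by simp [η, h0 (ρ x) (not_le.1 hlt).le])
      exact fun x hx => (hΩ x (hψB (hsub hx).1)).2 (hτ.trans_le (hsub hx).2)
    have hlap : ∀ x, laplace η x = laplace ψ x * θ (ρ x) + θ' (ρ x) * A x + θ'' (ρ x) * B x := by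
      intro x
      have h1 : ∀ i, pderiv i (fun y => θ (ρ y)) x = θ' (ρ x) * pderiv i ρ x := fun i =>
        pderiv_comp (hd _) (hρ.differentiable two_ne_zero x) i
      have h3 : ∑ i, pderiv i ψ x * (θ' (ρ x) * pderiv i ρ x)
          = θ' (ρ x) * ∑ i, pderiv i ψ x * pderiv i ρ x := by
        rw [Finset.mul_sum]
        exact Finset.sum_congr rfl fun i _ => by ring
      simp only [η]
      rw [laplace_mul (g := fun y => θ (ρ y)) hψ (hθC.comp hρ) x, laplace_comp hρ hd hd' x]
      simp only [h1, h3, A, B]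
      ring
    set S1 := collar e γ x₀ (r / 2) (2 * δ)
    set S2 := collar e γ x₀ (r / 2) (3 * τ)
    have hpt : ∀ x, p x * laplace η x ≤ p x * (laplace ψ x * θ (ρ x))
        + (3 / δ * CA * S1.indicator p x + 3 / (δ * τ) * CB * S2.indicator p x) := by
      intro x
      have hi : ∀ S : Set 𝔼, 0 ≤ S.indicator p x := fun S =>
        Set.indicator_nonneg (fun y _ => hp0 y) x
      have hr1 : 0 ≤ 3 / δ * CA * S1.indicator p x := mul_nonneg (by positivity) (hi S1)
      have hr2 : 0 ≤ 3 / (δ * τ) * CB * S2.indicator p x := mul_nonneg (by positivity) (hi S2)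
      by_cases hxs : x ∈ tsupport ψ
      swap
      · rw [hlap, hA0 x hxs, hB0 x hxs]
        linarith
      by_cases hxΩ : x ∈ Ω
      swap
      · rw [hpΩ x hxΩ]
        linarith
      have hxB := hψB hxs
      have hρ0 : 0 < ρ x := (hΩ x hxB).1 hxΩ
      have e1 : p x * (θ' (ρ x) * A x) ≤ 3 / δ * CA * S1.indicator p x := by
        by_cases hx1 : ρ x < 2 * δ
        · rw [Set.indicator_of_mem (show x ∈ S1 from ⟨hxB, hρ0, hx1⟩), mul_comm]
          refine mul_le_mul_of_nonneg_right ((le_abs_self _).trans ?_) (hp0 x)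
          rw [abs_mul]
          exact mul_le_mul (hθ' _) (hCA x) (abs_nonneg _) (by positivity)
        · rw [hθ'2 _ (not_lt.1 hx1)]
          linarith
      have e2 : p x * (θ'' (ρ x) * B x) ≤ 3 / (δ * τ) * CB * S2.indicator p x := by
        by_cases hx1 : ρ x < 3 * τ
        · rw [Set.indicator_of_mem (show x ∈ S2 from ⟨hxB, hρ0, hx1⟩), mul_comm]
          refine mul_le_mul_of_nonneg_right ?_ (hp0 x)
          exact mul_le_mul (hθ'' _) ((le_abs_self _).trans (hCB x)) (hBpos x) (by positivity)
        · refine le_trans ?_ hr2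
          exact mul_nonpos_of_nonneg_of_nonpos (hp0 x)
            (mul_nonpos_of_nonpos_of_nonneg (hθ''3 _ (not_lt.1 hx1)) (hBpos x))
      rw [hlap]
      linarith
    have i1 : Integrable fun x => p x * laplace η x := by
      obtain ⟨C, hC⟩ := hη.continuous_laplace.bounded_above_of_compact_support hηc.laplace
      exact hp.mul_bdd hη.continuous_laplace.aestronglyMeasurable (ae_of_all _ hC)
    have i2 : Integrable fun x => p x * (laplace ψ x * θ (ρ x)) := by
      have hc : Continuous fun x => laplace ψ x * θ (ρ x) :=
        hψ.continuous_laplace.mul (hcontθ hθC.continuous)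
      obtain ⟨C, hC⟩ := hc.bounded_above_of_compact_support hψc.laplace.mul_right
      exact hp.mul_bdd hc.aestronglyMeasurable (ae_of_all _ hC)
    have i3 : Integrable fun x => 3 / δ * CA * S1.indicator p x :=
      (hp.indicator (hmeas _)).const_mul _
    have i4 : Integrable fun x => 3 / (δ * τ) * CB * S2.indicator p x :=
      (hp.indicator (hmeas _)).const_mul _
    have hfin := integral_mono i1 (i2.add (i3.add i4)) hpt
    have i5 : Integrable fun x => 3 / δ * CA * S1.indicator p x
        + 3 / (δ * τ) * CB * S2.indicator p x := i3.add i4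
    have hsum : ∫ x, p x * (laplace ψ x * θ (ρ x))
        + (3 / δ * CA * S1.indicator p x + 3 / (δ * τ) * CB * S2.indicator p x)
        = (∫ x, p x * (laplace ψ x * θ (ρ x)))
          + (3 / δ * CA * (∫ x in S1, p x) + 3 / (δ * τ) * CB * ∫ x in S2, p x) := by
      rw [integral_add i2 i5, integral_add i3 i4, integral_const_mul, integral_const_mul,
        integral_indicator (hmeas _), integral_indicator (hmeas _)]
    have hb1 : 3 / δ * CA * (∫ x in S1, p x) ≤ 6 * CA * ε := by
      calc 3 / δ * CA * (∫ x in S1, p x) ≤ 3 / δ * CA * (2 * δ * ε) := by gcongr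
        _ = 6 * CA * ε := by field_simp; ring
    have hb2 : 3 / (δ * τ) * CB * (∫ x in S2, p x) ≤ 9 * CB * ε := by
      calc 3 / (δ * τ) * CB * (∫ x in S2, p x) ≤ 3 / (δ * τ) * CB * (3 * τ * (δ * ε)) := by gcongr
        _ = 9 * CB * ε := by field_simp; ring
    have h5 := hK η hη hηc hηs fun x => mul_nonneg (hψ0 x) (hθ0 _)
    have h6 : ∫ x, p x * laplace η x ≤ (∫ x, p x * (laplace ψ x * θ (ρ x)))
          + (3 / δ * CA * (∫ x in S1, p x) + 3 / (δ * τ) * CB * ∫ x in S2, p x) := by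
      rw [← hsum]
      exact hfin
    calc _ ≤ _ := h5.trans h6
      _ ≤ _ := by linarith
  choose θ hθc hθ0 hθ1 hθ2 hθ using key
  have hone : ∀ s, 0 < s → ∀ᶠ n in atTop, θ n s = 1 := fun s hs => by
    have h1 : Tendsto (fun n : ℕ => 2 * (1 / ((n : ℝ) + 1))) atTop (𝓝 0) := by
      simpa using tendsto_one_div_add_atTop_nhds_zero_nat.const_mul (2 : ℝ)
    filter_upwards [h1.eventually (gt_mem_nhds hs)] with n hn
    exact hθ2 n s hn.le
  -- The cutoffs tend to `1` wherever the height is positive, hence on `Ω` within the support of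
  -- `ψ`; dominated convergence removes them.
  have hlim : ∀ {f k : 𝔼 → ℝ} {C : ℝ}, Integrable f → (∀ x ∉ Ω, f x = 0) → Continuous k →
      (∀ x, ‖k x‖ ≤ C) → (∀ x ∉ tsupport ψ, k x = 0) →
      Tendsto (fun n => ∫ x, f x * (k x * θ n (ρ x))) atTop (𝓝 (∫ x, f x * k x)) := by
    intro f k C hf hfΩ hk hkC hk0
    refine tendsto_integral_of_dominated_convergence (fun x => ‖f x‖ * C)
      (fun n => hf.aestronglyMeasurable.mul
        (hk.mul (hcontθ (hθc n))).aestronglyMeasurable) (hf.norm.mul_const C)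
      (fun n => ae_of_all _ fun x => ?_) (ae_of_all _ fun x => ?_)
    · rw [norm_mul, norm_mul]
      refine mul_le_mul_of_nonneg_left ?_ (norm_nonneg _)
      rw [Real.norm_eq_abs (θ n (ρ x)), abs_of_nonneg (hθ0 n _)]
      exact (mul_le_of_le_one_right (norm_nonneg _) (hθ1 n _)).trans (hkC x)
    · by_cases hxΩ : x ∈ Ω
      swap
      · simp [hfΩ x hxΩ]
      by_cases hxs : x ∈ tsupport ψ
      swap
      · simp [hk0 x hxs]
      refine tendsto_const_nhds.congr' ?_
      filter_upwards [hone (ρ x) ((hΩ x (hψB hxs)).1 hxΩ)] with n hn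
      rw [hn, mul_one]
  have t1 := hlim ((hp.const_mul lam).sub hg)
    (fun x hx => by simp [hpΩ x hx, hgΩ x hx]) hψ.continuous hCψ
    fun x hx => image_eq_zero_of_notMem_tsupport hx
  have t2 := hlim hp hpΩ hψ.continuous_laplace hCL hL0
  have t3 : Tendsto (fun n : ℕ => (6 * CA + 9 * CB) * (1 / ((n : ℝ) + 1))) atTop (𝓝 0) := by
    simpa using tendsto_one_div_add_atTop_nhds_zero_nat.const_mul (6 * CA + 9 * CB)
  have t4 := t2.add t3
  rw [add_zero] at t4
  exact le_of_tendsto_of_tendsto' t1 t4 hθ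

/-- A strong solution is a weak subsolution, because `H` is nonnegative. -/
lemma IsStrongSolution.isWeakSubsolution {Ω : Set 𝔼} (hΩ : IsOpen Ω) {q : ℝ≥0∞} {lam : ℝ}
    {H : 𝔼 → 𝔼 → ℝ} {f u : 𝔼 → ℝ} (hH : ∀ x ∈ Ω, ∀ ξ, 0 ≤ H x ξ) (hu : IntegrableOn u Ω)
    (hf : IntegrableOn f Ω) (h : IsStrongSolution Ω q lam H f u) :
    IsWeakSubsolution Ω lam (Ω.indicator u) (Ω.indicator f) := by
  obtain ⟨Du, D2u, hDu, hD2u, heq⟩ := h.equation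
  intro ψ hψ hψc hψs hψ0
  -- Local integrability is all that the weak derivatives provide; a test function supported
  -- compactly in `Ω` makes the products integrable.
  have hψi : ∀ {g : 𝔼 → ℝ}, LocallyIntegrableOn g Ω → ∀ {k : 𝔼 → ℝ}, Continuous k →
      HasCompactSupport k → tsupport k ⊆ Ω → Integrable (fun x => g x * k x)
        (volume.restrict Ω) := by
    intro g hg k hk hkc hks
    have h1 : IntegrableOn g (tsupport k) := hg.integrableOn_compact_subset hks hkc.isCompact
    have h2 : IntegrableOn (fun x => g x * k x) (tsupport k) :=
      h1.mul_continuousOn hk.continuousOn hkc.isCompact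
    have h3 : Integrable fun x => g x * k x :=
      (integrableOn_iff_integrable_of_support_subset fun x hx => subset_tsupport _ fun h0 =>
        hx (by simp [h0])).1 h2
    exact h3.integrableOn
  have hψ2 : ContDiff ℝ 2 ψ := contDiff_infty.1 hψ 2
  have hpd : ∀ i, ContDiff ℝ ∞ (pderiv i ψ) := fun i => hψ.pderiv (by simp) i
  have hpc : ∀ i, HasCompactSupport (pderiv i ψ) := fun i => hψc.pderiv i
  have hps : ∀ i, tsupport (pderiv i ψ) ⊆ Ω := fun i => (tsupport_pderiv_subset ψ i).trans hψs
  have hDi : ∀ i, LocallyIntegrableOn (fun x => D2u i x i) Ω := fun i => by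
    intro x hx
    obtain ⟨s, hs, hs'⟩ := (hD2u i).locallyIntegrableOn_gradient x hx
    exact ⟨s, hs, ((EuclideanSpace.proj i : 𝔼 →L[ℝ] ℝ).integrable_comp hs')⟩
  have hparts : ∀ i, ∫ x in Ω, u x * pderiv i (pderiv i ψ) x = ∫ x in Ω, D2u i x i * ψ x := by
    intro i
    have h1 := hDu.integral_eq i (pderiv i ψ) (hpd i) (hpc i) (hps i)
    have h2 := (hD2u i).integral_eq i ψ hψ hψc hψs
    simp only [pderiv] at h1 h2 ⊢
    rw [h1, h2, neg_neg]
  have hpp : ∀ i, Continuous (pderiv i (pderiv i ψ)) := fun i =>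
    ((hpd i).pderiv (m := 0) (by simp) i).continuous
  have hlap : ∫ x in Ω, u x * laplace ψ x = ∫ x in Ω, (∑ i, D2u i x i) * ψ x := by
    simp only [laplace, Finset.mul_sum, Finset.sum_mul]
    rw [integral_finsetSum, integral_finsetSum]
    · exact Finset.sum_congr rfl fun i _ => hparts i
    · exact fun i _ => hψi (hDi i) hψ.continuous hψc hψs
    · exact fun i _ => hψi hDu.locallyIntegrableOn (hpp i) ((hpc i).pderiv i)
        ((tsupport_pderiv_subset _ i).trans (hps i))
  have e1 : ∫ x, (lam * Ω.indicator u x - Ω.indicator f x) * ψ x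
      = ∫ x in Ω, (lam * u x - f x) * ψ x := by
    rw [← integral_indicator hΩ.measurableSet]
    refine integral_congr_ae (ae_of_all _ fun x => ?_)
    by_cases hx : x ∈ Ω <;> simp [hx]
  have e2 : ∫ x, Ω.indicator u x * laplace ψ x = ∫ x in Ω, u x * laplace ψ x := by
    rw [← integral_indicator hΩ.measurableSet]
    refine integral_congr_ae (ae_of_all _ fun x => ?_)
    by_cases hx : x ∈ Ω <;> simp [hx]
  rw [e1, e2, hlap]
  have hluf : IntegrableOn (fun x => lam * u x - f x) Ω :=
    Integrable.sub (Integrable.const_mul hu lam) hf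
  refine integral_mono_ae (hψi hluf.locallyIntegrableOn hψ.continuous hψc hψs) ?_ ?_
  · simp only [Finset.sum_mul]
    exact integrable_finsetSum _ fun i _ => hψi (hDi i) hψ.continuous hψc hψs
  · filter_upwards [heq, ae_restrict_mem hΩ.measurableSet] with x hx hxΩ
    refine mul_le_mul_of_nonneg_right ?_ (hψ0 x)
    linarith [hH x hxΩ (Du x)]

/-- The positive part of a strong solution, extended by zero, is a subsolution in the whole space;
this is expressed through its mollifications. -/
theorem IsStrongSolution.exists_mollify_posPart_subsolution {Ω : Set 𝔼}
    (hΩ : IsBoundedC2Domain Ω) {q : ℝ≥0∞} (hq : 1 ≤ q) {lam : ℝ} (hlam : 0 ≤ lam)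
    {H : 𝔼 → 𝔼 → ℝ} {f u : 𝔼 → ℝ} (hH : ∀ x ∈ Ω, ∀ ξ, 0 ≤ H x ξ) (hu : IntegrableOn u Ω)
    (hf : IntegrableOn f Ω) (h : IsStrongSolution Ω q lam H f u) :
    ∃ ε₀ > 0, ∀ φ : ContDiffBump (0 : 𝔼), φ.rOut < ε₀ → ∀ x,
      lam * mollify φ (Ω.indicator fun y => max (u y) 0) x
        - mollify φ (Ω.indicator fun y => max (f y) 0) x
        ≤ laplace (mollify φ (Ω.indicator fun y => max (u y) 0)) x := by
  have hm := hΩ.isOpen.measurableSet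
  have hfin : volume Ω ≠ ⊤ := hΩ.isBounded.measure_lt_top.ne
  set p : 𝔼 → ℝ := Ω.indicator fun y => max (u y) 0
  set g : 𝔼 → ℝ := Ω.indicator fun y => max (f y) 0
  have hui : Integrable (Ω.indicator u) := (integrable_indicator_iff hm).2 hu
  have hfi : Integrable (Ω.indicator f) := (integrable_indicator_iff hm).2 hf
  have hpu : ∀ x, p x = max (Ω.indicator u x) 0 := fun x => by
    by_cases hx : x ∈ Ω <;> simp [p, hx]
  have hgf : ∀ x, g x = max (Ω.indicator f x) 0 := fun x => by
    by_cases hx : x ∈ Ω <;> simp [g, hx]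
  have hp : Integrable p := (integrable_indicator_iff hm).2 hu.pos_part
  have hg : Integrable g := (integrable_indicator_iff hm).2 hf.pos_part
  have hp0 : ∀ x, 0 ≤ p x := fun x => hpu x ▸ le_max_right _ _
  have hpΩ : ∀ x ∉ Ω, p x = 0 := fun x hx => Set.indicator_of_notMem hx _
  have hgΩ : ∀ x ∉ Ω, g x = 0 := fun x hx => Set.indicator_of_notMem hx _
  have hsub := h.isWeakSubsolution hΩ.isOpen hH hu hf
  have hK : ∀ η : 𝔼 → ℝ, ContDiff ℝ 2 η → HasCompactSupport η → tsupport η ⊆ Ω →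
      (∀ x, 0 ≤ η x) → ∫ x, (lam * p x - g x) * η x ≤ ∫ x, p x * laplace η x := by
    intro η h1 h2 h3 h4
    simp only [hpu, hgf]
    exact hsub.kato hΩ.isOpen hlam hui hfi h1 h2 h3 h4
  have hcompact : IsCompact (frontier Ω) :=
    Metric.isCompact_of_isClosed_isBounded isClosed_frontier
      (hΩ.isBounded.closure.subset frontier_subset_closure)
  choose! r e γ hr he hγ hball using hΩ.boundary
  have hball' : ∀ x₀ ∈ frontier Ω, ∀ x ∈ Metric.ball x₀ (r x₀),
      x ∈ Ω ↔ 0 < graphHeight (e x₀) (γ x₀) x := fun x₀ hx₀ x hx => by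
    rw [hball x₀ hx₀ x hx, graphHeight, sub_pos]
  -- A uniform radius: each ball of radius `ε₁` about a boundary point lies in one half-size chart
  -- ball. Bumps of radius below `ε₁ / 2` whose closed ball meets the boundary then fit inside a
  -- chart.
  obtain ⟨ε₁, hε₁, hleb⟩ := lebesgue_number_lemma_of_metric
    (c := fun x₀ : frontier Ω => Metric.ball (x₀ : 𝔼) (r x₀ / 2)) hcompact
    (fun _ => Metric.isOpen_ball) fun x hx => Set.mem_iUnion.2
      ⟨⟨x, hx⟩, Metric.mem_ball_self (half_pos (hr x hx))⟩
  refine ⟨ε₁ / 2, by positivity, fun φ hφ y => ?_⟩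
  have hψ := contDiff_bump_sub φ y
  have hψ2 : ContDiff ℝ 2 fun t => φ.normed volume (y - t) :=
    contDiff_infty.1 hψ 2
  have hψc := hasCompactSupport_bump_sub φ y
  have hψs := tsupport_bump_sub_subset φ y
  have hψ0 : ∀ t, 0 ≤ φ.normed volume (y - t) := fun t => φ.nonneg_normed _
  refine mollify_sub_le_laplace_mollify hp hg φ y ?_
  by_cases hfr : (Metric.closedBall y φ.rOut ∩ frontier Ω).Nonempty
  · obtain ⟨z, hz, hzΩ⟩ := hfr
    obtain ⟨⟨x₀, hx₀⟩, hx₀b⟩ := hleb z hzΩ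
    have hsub2 : Metric.closedBall y φ.rOut ⊆ Metric.ball x₀ (r x₀ / 2) := fun t ht =>
      hx₀b (by
        have := dist_triangle_right t z y
        rw [Metric.mem_closedBall] at ht hz
        rw [Metric.mem_ball]
        linarith)
    refine subsolution_across_boundary (hγ x₀ hx₀)
      (fun x hx => hball' x₀ hx₀ x (Metric.ball_subset_ball (by linarith [hr x₀ hx₀]) hx))
      hp hg hp0 hpΩ hgΩ hK (fun ε hε => ?_) hψ2 hψc (hψs.trans hsub2) hψ0
    obtain ⟨δ₀, hδ₀, hb⟩ := h.memW10.exists_collar_bound hq hfin (hr x₀ hx₀) (he x₀ hx₀)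
      (hγ x₀ hx₀).continuous (hball' x₀ hx₀) hε
    refine ⟨δ₀, hδ₀, fun δ h1 h2 => le_trans ?_ (hb δ h1 h2)⟩
    have hSΩ : collar (e x₀) (γ x₀) x₀ (r x₀ / 2) δ ⊆ Ω := fun x hx =>
      (hball' x₀ hx₀ x (Metric.ball_subset_ball (by linarith [hr x₀ hx₀]) hx.1)).2 hx.2.1
    refine setIntegral_mono_on hp.integrableOn (hu.mono_set hSΩ).abs
      (measurableSet_collar _ (hγ x₀ hx₀).continuous _ _ _) fun x hx => ?_
    rw [hpu, Set.indicator_of_mem (hSΩ hx)]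
    exact max_le (le_abs_self _) (abs_nonneg _)
  -- A ball missing the boundary is connected, so it lies inside `Ω`, where Kato's inequality
  -- applies, or misses `Ω`, where everything vanishes.
  · by_cases hin : (Metric.closedBall y φ.rOut ∩ Ω).Nonempty
    · have hsubΩ : Metric.closedBall y φ.rOut ⊆ Ω := by
        by_contra hnot
        obtain ⟨t, ht, htΩ⟩ := Set.not_subset.1 hnot
        have hcov : ∀ z ∈ Metric.closedBall y φ.rOut, z ∉ Ω → z ∉ closure Ω := fun z hz hzΩ hzc =>
          hfr ⟨z, hz, hzc, fun hzi => hzΩ (interior_subset hzi)⟩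
        obtain ⟨z, -, hz1, hz2⟩ := (convex_closedBall y φ.rOut).isPreconnected Ω (closure Ω)ᶜ
          hΩ.isOpen isClosed_closure.isOpen_compl
          (fun z hz => or_iff_not_imp_left.2 (hcov z hz)) hin ⟨t, ht, hcov t ht htΩ⟩
        exact hz2 (subset_closure hz1)
      exact hK _ hψ2 hψc (hψs.trans hsubΩ) hψ0
    · have hzero : ∀ t ∈ Ω, t ∉ tsupport fun t => φ.normed volume (y - t) := fun t ht hts =>
        hin ⟨t, hψs hts, ht⟩
      refine le_of_eq (integral_congr_ae (ae_of_all _ fun t => ?_))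
      by_cases ht : t ∈ Ω
      · have h1 := image_eq_zero_of_notMem_tsupport (hzero t ht)
        simp only at h1
        simp [h1, laplace_eq_zero_of_notMem_tsupport (hzero t ht)]
      · simp [hpΩ t ht, hgΩ t ht]

end Boundary

/-! ### The `L^p` bound for smooth subsolutions. -/

section Estimates

open Filter Topology

variable {d : ℕ}

local notation "𝔼" => EuclideanSpace ℝ (Fin d)

/-- Mollification does not increase `L^q` norms. -/
lemma eLpNorm_mollify_le (φ : ContDiffBump (0 : 𝔼)) {g : 𝔼 → ℝ} (hg : Integrable g) {q : ℝ}
    (hq : 1 ≤ q) :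
    eLpNorm (mollify φ g) (ENNReal.ofReal q) volume ≤ eLpNorm g (ENNReal.ofReal q) volume := by
  have hq0 : 0 < q := by linarith
  have hqe : ENNReal.ofReal q ≠ 0 := by simpa using hq0
  set k : 𝔼 → ℝ≥0∞ := fun t => ENNReal.ofReal (φ.normed volume t)
  have hk : Measurable k := φ.continuous_normed.measurable.ennreal_ofReal
  have hk1 : ∫⁻ t, k t = 1 := by
    rw [← ofReal_integral_eq_lintegral_ofReal φ.integrable_normed (ae_of_all _ φ.nonneg_normed),
      φ.integral_normed, ENNReal.ofReal_one]
  have hkx : ∀ x, ∫⁻ t, k (x - t) = 1 := fun x => by rw [lintegral_sub_left_eq_self k x, hk1]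
  have hgm : AEMeasurable (fun t => ‖g t‖ₑ ^ q) := hg.aestronglyMeasurable.enorm.pow_const q
  have hpt : ∀ x, ‖mollify φ g x‖ₑ ^ q ≤ ∫⁻ t, k (x - t) * ‖g t‖ₑ ^ q := by
    intro x
    have hkm : Measurable fun t => k (x - t) := hk.comp (by fun_prop)
    -- The mollification at `x` is a mean for this probability measure, so Jensen's inequality, in
    -- the form of monotonicity of `L^q` norms in the exponent, bounds its `q`-th power.
    set ν : Measure 𝔼 := volume.withDensity fun t => k (x - t)
    have : IsProbabilityMeasure ν :=
      ⟨by rw [withDensity_apply _ MeasurableSet.univ, setLIntegral_univ, hkx]⟩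
    have hac : ν ≪ volume := withDensity_absolutelyContinuous _ _
    have h1 : ‖mollify φ g x‖ₑ ≤ eLpNorm g 1 ν := by
      rw [eLpNorm_one_eq_lintegral_enorm, lintegral_withDensity_eq_lintegral_mul₀
        hkm.aemeasurable hg.aestronglyMeasurable.enorm, mollify_apply]
      refine (enorm_integral_le_lintegral_enorm _).trans_eq (lintegral_congr fun t => ?_)
      rw [enorm_mul, Real.enorm_eq_ofReal (φ.nonneg_normed _)]
      rfl
    have h2 := h1.trans (eLpNorm_le_eLpNorm_of_exponent_le (q := ENNReal.ofReal q) (μ := ν)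
      (by simpa using hq) (hg.aestronglyMeasurable.mono_ac hac))
    calc ‖mollify φ g x‖ₑ ^ q ≤ eLpNorm g (ENNReal.ofReal q) ν ^ q :=
          ENNReal.rpow_le_rpow h2 hq0.le
      _ = ∫⁻ t, ‖g t‖ₑ ^ q ∂ν := by
          rw [eLpNorm_eq_lintegral_rpow_enorm_toReal hqe ENNReal.ofReal_ne_top,
            ENNReal.toReal_ofReal hq0.le, ← ENNReal.rpow_mul, one_div, inv_mul_cancel₀ hq0.ne',
            ENNReal.rpow_one]
      _ = ∫⁻ t, k (x - t) * ‖g t‖ₑ ^ q :=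
          lintegral_withDensity_eq_lintegral_mul₀ hkm.aemeasurable hgm
  rw [eLpNorm_eq_lintegral_rpow_enorm_toReal hqe ENNReal.ofReal_ne_top,
    eLpNorm_eq_lintegral_rpow_enorm_toReal hqe ENNReal.ofReal_ne_top,
    ENNReal.toReal_ofReal hq0.le]
  refine ENNReal.rpow_le_rpow ?_ (by positivity)
  calc ∫⁻ x, ‖mollify φ g x‖ₑ ^ q ≤ ∫⁻ x, ∫⁻ t, k (x - t) * ‖g t‖ₑ ^ q := lintegral_mono hpt
    _ = ∫⁻ t, ∫⁻ x, k (x - t) * ‖g t‖ₑ ^ q := by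
        refine lintegral_lintegral_swap ?_
        exact ((hk.comp (by fun_prop : Measurable fun p : 𝔼 × 𝔼 => p.1 - p.2)).aemeasurable).mul
          (hgm.comp_quasiMeasurePreserving Measure.quasiMeasurePreserving_snd)
    _ = ∫⁻ t, ‖g t‖ₑ ^ q := by
        refine lintegral_congr fun t => ?_
        rw [lintegral_mul_const (f := fun x => k (x - t)) _ (hk.comp (by fun_prop)), lintegral_sub_right_eq_self k t, hk1,
          one_mul]

lemma hasCompactSupport_mollify (φ : ContDiffBump (0 : 𝔼)) {g : 𝔼 → ℝ}
    (hg : HasCompactSupport g) : HasCompactSupport (mollify φ g) :=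
  HasCompactSupport.convolution _ φ.hasCompactSupport_normed hg

lemma norm_fderiv_sq (W : 𝔼 → ℝ) (x : 𝔼) : ‖fderiv ℝ W x‖ ^ 2 = ∑ i, pderiv i W x ^ 2 := by
  have h1 : ‖fderiv ℝ W x‖ = ‖gradient W x‖ := by rw [gradient, LinearIsometryEquiv.norm_map]
  rw [h1, EuclideanSpace.real_norm_sq_eq]
  refine Finset.sum_congr rfl fun i _ => ?_
  congr 1
  have h2 : inner ℝ (gradient W x) (EuclideanSpace.single i (1 : ℝ)) = pderiv i W x := by
    rw [gradient, InnerProductSpace.toDual_symm_apply]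
    rfl
  rw [← h2, EuclideanSpace.inner_single_right]
  simp

/-- The Sobolev inequality for `p = 2` in dimension at least three, in terms of integrals. -/
lemma exists_sobolev_const (hd : 2 < d) : ∃ K : ℝ, 0 ≤ K ∧ ∀ W : 𝔼 → ℝ, ContDiff ℝ 1 W →
    HasCompactSupport W → (∀ x, 0 ≤ W x) →
    (∫ x, W x ^ (2 * (d : ℝ) / ((d : ℝ) - 2))) ^ (((d : ℝ) - 2) / (d : ℝ))
      ≤ K * ∫ x, ∑ i, pderiv i W x ^ 2 := by
  have hd' : (2 : ℝ) < d := by exact_mod_cast hd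
  have hd2 : 0 < (d : ℝ) - 2 := by linarith
  set P : ℝ := 2 * (d : ℝ) / ((d : ℝ) - 2)
  have hP : 0 < P := by positivity
  set C : NNReal := eLpNormLESNormFDerivOfEqInnerConst (volume : Measure 𝔼) 2
  refine ⟨(C : ℝ) ^ 2, by positivity, fun W hW hWc hW0 => ?_⟩
  have hfr : Module.finrank ℝ 𝔼 = d := by simp
  have hgns := eLpNorm_le_eLpNorm_fderiv_of_eq_inner (volume : Measure 𝔼) hW hWc (p := 2)
    (p' := P.toNNReal) one_le_two (by rw [hfr]; omega) (by
      rw [hfr, Real.coe_toNNReal _ hP.le]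
      simp only [P]
      push_cast
      field_simp)
  have hWm : MemLp W P.toNNReal := hW.continuous.memLp_of_hasCompactSupport hWc
  have hfm : MemLp (fderiv ℝ W) ((2 : NNReal) : ℝ≥0∞) :=
    (hW.continuous_fderiv one_ne_zero).memLp_of_hasCompactSupport (hWc.fderiv ℝ)
  have hPne : (P.toNNReal : ℝ≥0∞) ≠ 0 := by simpa using hP
  rw [hWm.eLpNorm_eq_integral_rpow_norm hPne ENNReal.coe_ne_top,
    hfm.eLpNorm_eq_integral_rpow_norm (by simp) ENNReal.coe_ne_top] at hgns
  simp only [ENNReal.coe_toReal, NNReal.coe_ofNat, Real.coe_toNNReal _ hP.le] at hgns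
  have hI2 : ∀ x, ‖fderiv ℝ W x‖ ^ (2 : ℝ) = ∑ i, pderiv i W x ^ 2 := fun x => by
    rw [← norm_fderiv_sq]
    norm_cast
  simp only [hI2, Real.norm_of_nonneg (hW0 _)] at hgns
  set I := ∫ x, W x ^ P
  set J := ∫ x, ∑ i, pderiv i W x ^ 2
  have hI : 0 ≤ I := integral_nonneg fun x => Real.rpow_nonneg (hW0 x) _
  have hJ : 0 ≤ J := integral_nonneg fun x => Finset.sum_nonneg fun i _ => sq_nonneg _
  rw [← ENNReal.ofReal_coe_nnreal, ← ENNReal.ofReal_mul (by positivity),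
    ENNReal.ofReal_le_ofReal_iff (by positivity)] at hgns
  have h := pow_le_pow_left₀ (by positivity) hgns 2
  calc I ^ (((d : ℝ) - 2) / d) = (I ^ P⁻¹) ^ 2 := by
        rw [← Real.rpow_natCast, ← Real.rpow_mul hI]
        congr 1
        simp only [P]
        push_cast
        field_simp
    _ ≤ _ := h
    _ = (C : ℝ) ^ 2 * J := by
        rw [mul_pow, ← Real.rpow_natCast (J ^ _), ← Real.rpow_mul hJ]
        norm_num
        exact Or.inl rfl

lemma contDiff_rpow_const {v : 𝔼 → ℝ} (hv : ContDiff ℝ 1 v) {m : ℝ} (hm : 1 ≤ m) :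
    ContDiff ℝ 1 fun x => v x ^ m :=
  hv.rpow_const_of_le (by simpa using hm)

/-- The energy estimate obtained by testing with a power of the subsolution. -/
lemma integral_sum_pderiv_rpow_sq_le {v F : 𝔼 → ℝ} (hv : ContDiff ℝ 2 v)
    (hvc : HasCompactSupport v) (hv0 : ∀ x, 0 ≤ v x) (hF : Continuous F)
    (h : ∀ x, - F x ≤ laplace v x) {m : ℝ} (hm : 1 < m) :
    m * ∫ x, ∑ i, pderiv i (fun y => v y ^ ((m + 1) / 2)) x ^ 2
      ≤ ((m + 1) / 2) ^ 2 * ∫ x, F x * v x ^ m := by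
  have hv1 : ContDiff ℝ 1 v := hv.of_le one_le_two
  have hvm := contDiff_rpow_const hv1 hm.le
  have hvmc := hvc.rpow_const (r := m) (by linarith)
  have e1 := integral_mul_laplace_left hv hvm hvmc
  have hp : ∀ {a : ℝ}, 1 ≤ a → ∀ x i, pderiv i (fun y => v y ^ a) x
      = a * v x ^ (a - 1) * pderiv i v x := fun ha x i =>
    pderiv_comp (Real.hasDerivAt_rpow_const (Or.inr ha)) (hv1.differentiable one_ne_zero x) i
  have e2 : ∀ x, ∑ i, pderiv i (fun y => v y ^ ((m + 1) / 2)) x ^ 2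
      = ((m + 1) / 2) ^ 2 * (v x ^ (m - 1) * ∑ i, pderiv i v x ^ 2) := fun x => by
    have : (v x ^ ((m + 1) / 2 - 1)) ^ 2 = v x ^ (m - 1) := by
      rw [← Real.rpow_natCast, ← Real.rpow_mul (hv0 x)]
      congr 1
      push_cast
      ring
    simp only [hp (show 1 ≤ (m + 1) / 2 by linarith), mul_pow, this, Finset.mul_sum, mul_assoc]
  have e3 : ∀ x, ∑ i, pderiv i v x * pderiv i (fun y => v y ^ m) x
      = m * (v x ^ (m - 1) * ∑ i, pderiv i v x ^ 2) := fun x => by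
    simp only [hp hm.le, Finset.mul_sum]
    exact Finset.sum_congr rfl fun i _ => by ring
  simp only [e3, integral_const_mul] at e1
  simp only [e2, integral_const_mul]
  have e4 : - ∫ x, F x * v x ^ m ≤ ∫ x, laplace v x * v x ^ m := by
    rw [← integral_neg]
    refine integral_mono
      (hF.mul hvm.continuous |>.integrable_of_hasCompactSupport hvmc.mul_left).neg
      (hv.continuous_laplace.mul hvm.continuous |>.integrable_of_hasCompactSupport hvmc.mul_left)
      fun x => ?_
    have := mul_le_mul_of_nonneg_right (h x) (Real.rpow_nonneg (hv0 x) m)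
    simp only
    linarith
  have : 0 ≤ ((m + 1) / 2) ^ 2 := sq_nonneg _
  nlinarith

/-- The `L^p` estimate for smooth compactly supported subsolutions. -/
lemma exists_Lp_estimate {q : ℝ} (hq : 2 * (d : ℝ) / ((d : ℝ) + 2) < q) (hqd : q < (d : ℝ) / 2) :
    ∃ C : ℝ, 0 < C ∧ ∀ v F : 𝔼 → ℝ, ContDiff ℝ 2 v → HasCompactSupport v → (∀ x, 0 ≤ v x) →
      Continuous F → HasCompactSupport F → (∀ x, 0 ≤ F x) → (∀ x, - F x ≤ laplace v x) →
      eLpNorm v (ENNReal.ofReal ((d : ℝ) * q / ((d : ℝ) - 2 * q))) volume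
        ≤ ENNReal.ofReal C * eLpNorm F (ENNReal.ofReal q) volume := by
  have hdn : (0 : ℝ) ≤ d := Nat.cast_nonneg d
  have hq2 : 2 * (d : ℝ) < q * ((d : ℝ) + 2) := (div_lt_iff₀ (by positivity)).1 hq
  -- The two bounds on `q` are compatible only for `d > 2`, which Sobolev's inequality with exponent
  -- two requires; in the plane this case is empty.
  have hd2' : (2 : ℝ) < d := by nlinarith
  have hd2 : 2 < d := by exact_mod_cast hd2'
  have hq1 : 1 < q := by nlinarith
  have hq0 : 0 < q := by linarith
  have hdq : 0 < (d : ℝ) - 2 * q := by linarith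
  have hd0 : (0 : ℝ) < d := by linarith
  have hdm2 : 0 < (d : ℝ) - 2 := by linarith
  have hqm : 0 < q - 1 := by linarith
  set p : ℝ := (d : ℝ) * q / ((d : ℝ) - 2 * q)
  have hp : 0 < p := by positivity
  -- The exponent for which `m q' = p`, needed in Hölder, and `(m + 1)/2` times the Sobolev exponent
  -- `2d/(d - 2)` is also `p`.
  set m : ℝ := (d : ℝ) * (q - 1) / ((d : ℝ) - 2 * q)
  have hm : 1 < m := by
    rw [lt_div_iff₀ hdq]
    nlinarith
  set q' : ℝ := q / (q - 1)
  have hconj : q'.HolderConjugate q := (Real.HolderConjugate.conjExponent hq1).symm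
  obtain ⟨K, hK0, hK⟩ := exists_sobolev_const hd2
  set C : ℝ := K * (((m + 1) / 2) ^ 2 / m)
  refine ⟨C + 1, by positivity, fun v F hv hvc hv0 hF hFc hF0 h => ?_⟩
  have hv1 : ContDiff ℝ 1 v := hv.of_le one_le_two
  have hvp : MemLp v (ENNReal.ofReal p) := hv.continuous.memLp_of_hasCompactSupport hvc
  have hFq : MemLp F (ENNReal.ofReal q) := hF.memLp_of_hasCompactSupport hFc
  set N := ∫ x, v x ^ p
  set A := ∫ x, F x ^ q
  have hN0 : 0 ≤ N := integral_nonneg fun x => Real.rpow_nonneg (hv0 x) _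
  have hA0 : 0 ≤ A := integral_nonneg fun x => Real.rpow_nonneg (hF0 x) _
  have hm0 : m ≠ 0 := by linarith
  have hsob := hK (fun x => v x ^ ((m + 1) / 2)) (contDiff_rpow_const hv1 (by linarith))
    (hvc.rpow_const (by linarith)) fun x => Real.rpow_nonneg (hv0 x) _
  have hexp : (m + 1) / 2 * (2 * (d : ℝ) / ((d : ℝ) - 2)) = p := by
    have : m + 1 = q * ((d : ℝ) - 2) / ((d : ℝ) - 2 * q) := by
      rw [eq_div_iff hdq.ne', add_mul, div_mul_cancel₀ _ hdq.ne']
      ring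
    rw [this]
    simp only [p]
    field_simp
  have hexp2 : m * q' = p := by
    simp only [m, p, q']
    field_simp
  simp only [← Real.rpow_mul (hv0 _), hexp] at hsob
  have hen := integral_sum_pderiv_rpow_sq_le hv hvc hv0 hF h hm
  have hhol : ∫ x, F x * v x ^ m ≤ N ^ (1 / q') * A ^ (1 / q) := by
    have hvm : MemLp (fun x => v x ^ m) (ENNReal.ofReal q') :=
      (contDiff_rpow_const hv1 hm.le).continuous.memLp_of_hasCompactSupport (hvc.rpow_const hm0)
    have := integral_mul_le_Lp_mul_Lq_of_nonneg hconj
      (ae_of_all volume fun x => Real.rpow_nonneg (hv0 x) m) (ae_of_all volume hF0) hvm hFq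
    simp only [← Real.rpow_mul (hv0 _), hexp2] at this
    simpa only [mul_comm (F _)] using this
  have hmain : N ^ (((d : ℝ) - 2) / d) ≤ C * (N ^ (1 / q') * A ^ (1 / q)) := by
    refine hsob.trans ?_
    have h1 : ∫ x, ∑ i, pderiv i (fun y => v y ^ ((m + 1) / 2)) x ^ 2
        ≤ ((m + 1) / 2) ^ 2 / m * (N ^ (1 / q') * A ^ (1 / q)) := by
      have h2 := hen.trans (mul_le_mul_of_nonneg_left hhol (sq_nonneg ((m + 1) / 2)))
      rw [div_mul_eq_mul_div, le_div_iff₀ (by linarith)]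
      linarith
    calc _ ≤ K * (((m + 1) / 2) ^ 2 / m * (N ^ (1 / q') * A ^ (1 / q))) :=
          mul_le_mul_of_nonneg_left h1 hK0
      _ = _ := by simp only [C]; ring
  have hfinal : N ^ p⁻¹ ≤ (C + 1) * A ^ q⁻¹ := by
    have hC0 : 0 ≤ C := by positivity
    rcases hN0.eq_or_lt with hN | hN
    · rw [← hN, Real.zero_rpow (by positivity)]
      positivity
    -- Since `(d - 2)/d = 1/p + 1/q'`, the factor `N ^ (1 / q')` cancels. Finiteness of `N`,
    -- guaranteed by compact support, is what makes this absorption legitimate.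
    have h1 : N ^ (((d : ℝ) - 2) / d) = N ^ p⁻¹ * N ^ (1 / q') := by
      rw [← Real.rpow_add hN]
      congr 1
      simp only [p, q']
      field_simp
      ring
    have hNq : 0 < N ^ (1 / q') := Real.rpow_pos_of_pos hN _
    have h2 : N ^ p⁻¹ * N ^ (1 / q') ≤ C * A ^ (1 / q) * N ^ (1 / q') := by
      rw [← h1]
      linarith
    have h3 := le_of_mul_le_mul_right h2 hNq
    rw [one_div] at h3
    have : 0 ≤ A ^ q⁻¹ := by positivity
    linarith
  rw [hvp.eLpNorm_eq_integral_rpow_norm (by simpa using hp) ENNReal.ofReal_ne_top,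
    hFq.eLpNorm_eq_integral_rpow_norm (by simpa using hq0) ENNReal.ofReal_ne_top,
    ENNReal.toReal_ofReal hp.le, ENNReal.toReal_ofReal hq0.le, ← ENNReal.ofReal_mul (by positivity)]
  simp only [Real.norm_of_nonneg (hv0 _), Real.norm_of_nonneg (hF0 _)]
  exact ENNReal.ofReal_le_ofReal hfinal

end Estimates

/-! ### The supremum bound by weighted ball means. -/

section SupEstimate

open Filter Topology

variable {d : ℕ}

local notation "𝔼" => EuclideanSpace ℝ (Fin d)

/-- The radial weight `max (1 - |z|²) 0 ^ k`. -/
noncomputable def ballWeight (k : ℕ) (z : 𝔼) : ℝ := max (1 - ‖z‖ ^ 2) 0 ^ k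

lemma continuous_ballWeight (k : ℕ) : Continuous (ballWeight k : 𝔼 → ℝ) := by
  unfold ballWeight
  fun_prop

lemma ballWeight_nonneg (k : ℕ) (z : 𝔼) : 0 ≤ ballWeight k z := pow_nonneg (le_max_right _ _) k

lemma ballWeight_le_one (k : ℕ) (z : 𝔼) : ballWeight k z ≤ 1 :=
  pow_le_one₀ (le_max_right _ _) (max_le (by linarith [sq_nonneg ‖z‖]) zero_le_one)

lemma ballWeight_eq_zero {k : ℕ} (hk : k ≠ 0) {z : 𝔼} (hz : 1 ≤ ‖z‖) : ballWeight k z = 0 := by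
  rw [ballWeight, max_eq_right (by nlinarith), zero_pow hk]

lemma hasCompactSupport_ballWeight {k : ℕ} (hk : k ≠ 0) :
    HasCompactSupport (ballWeight k : 𝔼 → ℝ) :=
  HasCompactSupport.intro (isCompact_closedBall 0 1) fun z hz =>
    ballWeight_eq_zero hk (by simpa using (not_le.1 fun h => hz (by simpa using h)).le)

lemma integral_ballWeight_pos (k : ℕ) (hk : k ≠ 0) : 0 < ∫ z : 𝔼, ballWeight k z := by
  rw [integral_pos_iff_support_of_nonneg (ballWeight_nonneg k)
    ((continuous_ballWeight k).integrable_of_hasCompactSupport (hasCompactSupport_ballWeight hk))]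
  refine ((continuous_ballWeight k).isOpen_support).measure_pos _ ⟨0, ?_⟩
  simp [ballWeight]

lemma contDiff_ballWeight : ContDiff ℝ 2 (ballWeight 3 : 𝔼 → ℝ) := by
  have h : ContDiff ℝ 2 fun t : ℝ => max t 0 ^ 3 :=
    contDiff_two_of_hasDerivAt (h' := fun s => 3 * max s 0 ^ 2) (h'' := fun s => 6 * max s 0)
      (fun s => by simpa using (hasDerivAt_max_zero_pow 1 s).congr_deriv (by norm_num))
      (fun s => ((hasDerivAt_max_zero_pow 0 s).const_mul 3).congr_deriv (by norm_num; ring))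
      (by fun_prop)
  exact h.comp (contDiff_const.sub (contDiff_norm_sq ℝ))

/-- This explains the weights in use: the field `6 * ballWeight 2 z • z` is minus the gradient of
the compactly supported `ballWeight 3`, so pairing it with `∇v` produces the Laplacian. -/
lemma pderiv_ballWeight (i : Fin d) (z : 𝔼) :
    pderiv i (ballWeight 3) z = -(6 * ballWeight 2 z * z i) := by
  have h1 : HasFDerivAt (fun y : 𝔼 => 1 - ‖y‖ ^ 2) (-(2 • innerSL ℝ z)) z :=
    (hasStrictFDerivAt_norm_sq z).hasFDerivAt.const_sub 1
  have h2 : pderiv i (fun y : 𝔼 => 1 - ‖y‖ ^ 2) z = -(2 * z i) := by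
    rw [pderiv, h1.fderiv]
    simp [EuclideanSpace.inner_single_right]
  have h3 := pderiv_comp (h := fun t => max t 0 ^ 3) (hasDerivAt_max_zero_pow 1 (1 - ‖z‖ ^ 2))
    h1.differentiableAt i
  rw [h2] at h3
  refine h3.trans ?_
  simp only [ballWeight]
  push_cast
  ring

lemma pderiv_comp_add_smul {g : 𝔼 → ℝ} (hg : Differentiable ℝ g) (x : 𝔼) (r : ℝ) (i : Fin d)
    (z : 𝔼) : pderiv i (fun y => g (x + r • y)) z = r * pderiv i g (x + r • z) := by
  have h1 : HasFDerivAt (fun y : 𝔼 => x + r • y) (r • ContinuousLinearMap.id ℝ 𝔼) z :=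
    ((hasFDerivAt_id z).const_smul r).const_add x
  have := ((hg (x + r • z)).hasFDerivAt.comp z h1).fderiv
  simp only [pderiv]
  change fderiv ℝ (g ∘ fun y => x + r • y) z _ = _
  rw [this]
  simp

lemma laplace_comp_add_smul {g : 𝔼 → ℝ} (hg : ContDiff ℝ 2 g) (x : 𝔼) (r : ℝ) (z : 𝔼) :
    laplace (fun y => g (x + r • y)) z = r ^ 2 * laplace g (x + r • z) := by
  simp only [laplace, Finset.mul_sum]
  refine Finset.sum_congr rfl fun i _ => ?_
  have h1 : pderiv i (fun y => g (x + r • y)) = fun y => r * pderiv i g (x + r • y) :=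
    funext fun y => pderiv_comp_add_smul (hg.differentiable two_ne_zero) x r i y
  have hd : Differentiable ℝ (pderiv i g) :=
    (hg.pderiv (m := 1) le_rfl i).differentiable one_ne_zero
  have hd' : DifferentiableAt ℝ (fun y => pderiv i g (x + r • y)) z :=
    (hd _).comp z (by fun_prop)
  have h2 := pderiv_comp_add_smul hd x r i z
  rw [h1]
  have h3 := pderiv_comp (h := fun t => r * t) ((hasDerivAt_id _).const_mul r) hd' i
  rw [h3, h2]
  ring

lemma fderiv_eq_sum_pderiv (g : 𝔼 → ℝ) (x z : 𝔼) :
    fderiv ℝ g x z = ∑ i, z i * pderiv i g x := by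
  have h : z = ∑ i, z i • EuclideanSpace.single i (1 : ℝ) := by
    simpa using ((EuclideanSpace.basisFun (Fin d) ℝ).sum_repr z).symm
  conv_lhs => rw [h]
  simp [pderiv]

/-- The derivative of a weighted mean over balls is controlled by the Laplacian. -/
lemma hasDerivAt_ball_mean {v : 𝔼 → ℝ} (hv : ContDiff ℝ 2 v) (hvc : HasCompactSupport v) (x : 𝔼)
    (r : ℝ) : HasDerivAt (fun s : ℝ => ∫ z, 6 * ballWeight 2 z * v (x + s • z))
      (∫ z, 6 * ballWeight 2 z * fderiv ℝ v (x + r • z) z) r := by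
  have hv1 : ContDiff ℝ 1 v := hv.of_le one_le_two
  have hfd := hv1.continuous_fderiv one_ne_zero
  obtain ⟨C, hC⟩ := hfd.bounded_above_of_compact_support (hvc.fderiv ℝ)
  have hg := continuous_ballWeight (d := d) 2
  have hgc := hasCompactSupport_ballWeight (d := d) two_ne_zero
  have hw : Continuous fun z : 𝔼 => 6 * ballWeight 2 z := continuous_const.mul hg
  have hwc : HasCompactSupport fun z : 𝔼 => 6 * ballWeight 2 z := hgc.mul_left
  have hvs : ∀ s : ℝ, Continuous fun z : 𝔼 => v (x + s • z) := fun s =>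
    hv.continuous.comp (by fun_prop)
  have hfs : ∀ s : ℝ, Continuous fun z : 𝔼 => fderiv ℝ v (x + s • z) z := fun s =>
    (hfd.comp (by fun_prop)).clm_apply continuous_id
  refine (hasDerivAt_integral_of_dominated_loc_of_deriv_le (s := Set.univ)
    (F' := fun s z => 6 * ballWeight 2 z * fderiv ℝ v (x + s • z) z)
    (bound := fun z => 6 * ballWeight 2 z * (C * ‖z‖)) Filter.univ_mem
    (Eventually.of_forall fun s => (hw.mul (hvs s)).aestronglyMeasurable)
    ((hw.mul (hvs r)).integrable_of_hasCompactSupport hwc.mul_right)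
    (hw.mul (hfs r)).aestronglyMeasurable (ae_of_all _ fun z s _ => ?_)
    ((hw.mul (continuous_const.mul continuous_norm)).integrable_of_hasCompactSupport hwc.mul_right)
    (ae_of_all _ fun z s _ => ?_)).2
  · have h6 : 0 ≤ 6 * ballWeight 2 z := mul_nonneg (by norm_num) (ballWeight_nonneg 2 z)
    rw [norm_mul, Real.norm_of_nonneg h6]
    refine mul_le_mul_of_nonneg_left ((ContinuousLinearMap.le_opNorm _ _).trans ?_) h6
    exact mul_le_mul_of_nonneg_right (hC _) (norm_nonneg _)
  · have h1 : HasDerivAt (fun s : ℝ => x + s • z) z s := by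
      simpa using ((hasDerivAt_id s).smul_const z).const_add x
    exact (((hv1.differentiable one_ne_zero _).hasFDerivAt).comp_hasDerivAt s h1).const_mul _

/-- Integration by parts against `ballWeight 3`. The rescaled Laplacian carries `r²` and the
rescaled gradient `r`, which leaves one factor `r`. -/
lemma integral_ballWeight_mul_fderiv {v : 𝔼 → ℝ} (hv : ContDiff ℝ 2 v) (x : 𝔼)
    {r : ℝ} (hr : 0 < r) :
    ∫ z, 6 * ballWeight 2 z * fderiv ℝ v (x + r • z) z
      = r * ∫ z, ballWeight 3 z * laplace v (x + r • z) := by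
  have hvr : ContDiff ℝ 2 fun z : 𝔼 => v (x + r • z) :=
    hv.comp (contDiff_const.add (contDiff_id.const_smul r))
  have e1 := integral_mul_laplace_left hvr ((contDiff_ballWeight (d := d)).of_le one_le_two)
    (hasCompactSupport_ballWeight three_ne_zero)
  have e2 : ∀ z, ∑ i, pderiv i (fun y => v (x + r • y)) z * pderiv i (ballWeight 3) z
      = -r * (6 * ballWeight 2 z * fderiv ℝ v (x + r • z) z) := fun z => by
    rw [fderiv_eq_sum_pderiv, Finset.mul_sum, Finset.mul_sum]
    refine Finset.sum_congr rfl fun i _ => ?_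
    rw [pderiv_comp_add_smul (hv.differentiable two_ne_zero), pderiv_ballWeight]
    ring
  simp only [e2, laplace_comp_add_smul hv, integral_const_mul] at e1
  have e3 : ∫ z, r ^ 2 * laplace v (x + r • z) * ballWeight 3 z
      = r ^ 2 * ∫ z, ballWeight 3 z * laplace v (x + r • z) := by
    rw [← integral_const_mul]
    exact integral_congr_ae (ae_of_all _ fun z => by simp only; ring)
  rw [e3] at e1
  have : r * (r * ∫ z, ballWeight 3 z * laplace v (x + r • z))
      = r * ∫ z, 6 * ballWeight 2 z * fderiv ℝ v (x + r • z) z := by linarith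
  exact (mul_left_cancel₀ hr.ne' this).symm

/-- The sup estimate for smooth compactly supported subsolutions. -/
lemma exists_sup_estimate {q lam : ℝ} (hq1 : 1 < q) (hqd : (d : ℝ) / 2 < q) (hlam : 0 < lam) :
    ∃ C : ℝ, 0 < C ∧ ∀ v F : 𝔼 → ℝ, ContDiff ℝ 2 v → HasCompactSupport v → (∀ x, 0 ≤ v x) →
      Continuous F → HasCompactSupport F → (∀ x, 0 ≤ F x) →
      (∀ x, lam * v x - F x ≤ laplace v x) →
      ∀ x, v x ≤ C * ((∫ y, F y) + (∫ y, F y ^ q) ^ (1 / q)) := by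
  have hq0 : 0 < q := by linarith
  set q' : ℝ := q / (q - 1)
  have hconj : q'.HolderConjugate q := (Real.HolderConjugate.conjExponent hq1).symm
  set A : ℝ := (∫ z : 𝔼, ballWeight 3 z ^ q') ^ (1 / q')
  have hA : 0 ≤ A := Real.rpow_nonneg
    (integral_nonneg fun z => Real.rpow_nonneg (ballWeight_nonneg 3 z) _) _
  -- The derivative of the mean is bounded below by a multiple of `-r ^ (α - 1)`, with one power of
  -- `r` from the Laplacian identity and `r ^ (-d/q)` from scaling the `L^q` norm. It is integrable
  -- at zero because `q > d/2`.
  set α : ℝ := 2 - d / q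
  have hα : 0 < α := by
    have : (d : ℝ) / q < 2 := by rw [div_lt_iff₀ hq0]; linarith
    simp only [α]
    linarith
  set G : ℝ := ∫ z : 𝔼, 6 * ballWeight 2 z
  have hG : 0 < G := by
    simp only [G, integral_const_mul]
    exact mul_pos (by norm_num) (integral_ballWeight_pos 2 two_ne_zero)
  refine ⟨(6 / lam + A / α) / G, by positivity, fun v F hv hvc hv0 hF hFc hF0 h x => ?_⟩
  set Φ : ℝ := (∫ y, F y ^ q) ^ (1 / q)
  have hFq0 : 0 ≤ ∫ y, F y ^ q := integral_nonneg fun y => Real.rpow_nonneg (hF0 y) _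
  have hΦ : 0 ≤ Φ := Real.rpow_nonneg hFq0 _
  have hFi : Integrable F := hF.integrable_of_hasCompactSupport hFc
  have hvi : Integrable v := hv.continuous.integrable_of_hasCompactSupport hvc
  have hLi : Integrable (laplace v) :=
    hv.continuous_laplace.integrable_of_hasCompactSupport hvc.laplace
  have hFi0 : 0 ≤ ∫ y, F y := integral_nonneg hF0
  -- The Laplacian of a compactly supported function has integral zero. This mass bound is where
  -- `lam` enters the constant.
  have hmass : lam * ∫ y, v y ≤ ∫ y, F y := by
    have h0 : ∫ y, laplace v y = 0 := by
      have := integral_mul_laplace (f := fun _ => (1 : ℝ)) contDiff_const hv hvc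
      simpa [pderiv] using this
    have h1 := integral_mono ((hvi.const_mul lam).sub hFi) hLi h
    have h2 : ∫ y, (lam * v y - F y) = lam * (∫ y, v y) - ∫ y, F y := by
      rw [integral_sub (hvi.const_mul lam) hFi, integral_const_mul]
    have h3 : (lam * ∫ y, v y) - ∫ y, F y ≤ ∫ y, laplace v y := h2 ▸ h1
    linarith
  set M : ℝ → ℝ := fun s => ∫ z, 6 * ballWeight 2 z * v (x + s • z)
  have hM := hasDerivAt_ball_mean hv hvc x
  have hder : ∀ r, 0 < r → -(A * Φ * r ^ (α - 1)) ≤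
      ∫ z, 6 * ballWeight 2 z * fderiv ℝ v (x + r • z) z := by
    intro r hr
    have hcont : Continuous fun z : 𝔼 => x + r • z := by fun_prop
    have hFr : Continuous fun z : 𝔼 => F (x + r • z) := hF.comp hcont
    have hFrc : HasCompactSupport fun z : 𝔼 => F (x + r • z) := by
      have := hFc.comp_homeomorph ((Homeomorph.smulOfNeZero r hr.ne').trans (Homeomorph.addLeft x))
      exact this
    have hwc := hasCompactSupport_ballWeight (d := d) three_ne_zero
    have hw := continuous_ballWeight (d := d) 3
    rw [integral_ballWeight_mul_fderiv hv x hr]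
    have hhol := integral_mul_le_Lp_mul_Lq_of_nonneg hconj
      (ae_of_all (volume : Measure 𝔼) (ballWeight_nonneg 3))
      (ae_of_all volume fun z : 𝔼 => hF0 (x + r • z))
      (hw.memLp_of_hasCompactSupport hwc) (hFr.memLp_of_hasCompactSupport hFrc)
    have hscale : ∫ z : 𝔼, F (x + r • z) ^ q = (r ^ d)⁻¹ * ∫ y, F y ^ q := by
      have h1 := Measure.integral_comp_smul (volume : Measure 𝔼) (fun y => F (x + y) ^ q) r
      have h2 := integral_add_left_eq_self (μ := (volume : Measure 𝔼)) (fun y => F y ^ q) x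
      rw [h2] at h1
      rw [h1]
      simp [abs_of_pos hr]
    have hpow : (∫ z : 𝔼, F (x + r • z) ^ q) ^ (1 / q) = r ^ (-((d : ℝ) / q)) * Φ := by
      rw [hscale, Real.mul_rpow (by positivity) hFq0, ← Real.rpow_natCast, ← Real.rpow_neg hr.le,
        ← Real.rpow_mul hr.le]
      congr 2
      ring
    rw [hpow] at hhol
    have hlow : -∫ z, ballWeight 3 z * F (x + r • z)
        ≤ ∫ z, ballWeight 3 z * laplace v (x + r • z) := by
      rw [← integral_neg]
      refine integral_mono ((hw.mul hFr).integrable_of_hasCompactSupport hwc.mul_right).neg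
        ((hw.mul (hv.continuous_laplace.comp hcont)).integrable_of_hasCompactSupport
          hwc.mul_right) fun z => ?_
      have h1 : - F (x + r • z) ≤ laplace v (x + r • z) := by
        have := mul_nonneg hlam.le (hv0 (x + r • z))
        linarith [h (x + r • z)]
      have := mul_le_mul_of_nonneg_left h1 (ballWeight_nonneg 3 z)
      simp only
      linarith
    have hrr : r ^ (α - 1) = r * r ^ (-((d : ℝ) / q)) := by
      rw [show α - 1 = 1 + -((d : ℝ) / q) by simp only [α]; ring, Real.rpow_add hr,
        Real.rpow_one]
    have hlow2 : -(A * (r ^ (-((d : ℝ) / q)) * Φ))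
        ≤ ∫ z, ballWeight 3 z * laplace v (x + r • z) := (neg_le_neg hhol).trans hlow
    have := mul_le_mul_of_nonneg_left hlow2 hr.le
    rw [hrr]
    linarith
  have hmono : M 0 ≤ M 1 + A * Φ / α := by
    -- Adding the primitive of the lower bound makes the mean nondecreasing; comparing radii `0` and
    -- `1` gives the claim.
    set N : ℝ → ℝ := fun s => M s + A * Φ / α * s ^ α
    have hNd : ∀ s, 0 < s → HasDerivAt N ((∫ z, 6 * ballWeight 2 z * fderiv ℝ v (x + s • z) z)
        + A * Φ / α * (α * s ^ (α - 1))) s := fun s hs =>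
      (hM s).add ((Real.hasDerivAt_rpow_const (Or.inl hs.ne')).const_mul _)
    have hNc : ContinuousOn N (Set.Icc 0 1) := by
      refine ContinuousOn.add
        (continuous_iff_continuousAt.2 fun s => (hM s).continuousAt).continuousOn
        (continuousOn_const.mul (Real.continuous_rpow_const hα.le).continuousOn)
    have hmon : MonotoneOn N (Set.Icc 0 1) := by
      refine monotoneOn_of_deriv_nonneg (convex_Icc 0 1) hNc ?_ ?_
      · rw [interior_Icc]
        exact fun s hs => (hNd s hs.1).differentiableAt.differentiableWithinAt
      · rw [interior_Icc]
        intro s hs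
        rw [(hNd s hs.1).deriv]
        have h1 := hder s hs.1
        have h2 : A * Φ / α * (α * s ^ (α - 1)) = A * Φ * s ^ (α - 1) := by
          field_simp
        linarith
    have := hmon (by simp) (by simp) (zero_le_one : (0 : ℝ) ≤ 1)
    simpa [N, Real.zero_rpow hα.ne'] using this
  have hM0 : M 0 = G * v x := by
    simp only [M, G, zero_smul, add_zero]
    rw [integral_mul_const]
  have hM1 : M 1 ≤ 6 / lam * ∫ y, F y := by
    have h1 : M 1 ≤ ∫ z, 6 * v (x + z) := by
      simp only [M, one_smul]
      have hvx : Continuous fun z : 𝔼 => v (x + z) := hv.continuous.comp (by fun_prop)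
      refine integral_mono (((continuous_const.mul (continuous_ballWeight 2)).mul
        hvx).integrable_of_hasCompactSupport
          ((hasCompactSupport_ballWeight two_ne_zero).mul_left).mul_right)
        ((hvi.comp_add_left x).const_mul 6) fun z => ?_
      have := ballWeight_le_one 2 z
      have := hv0 (x + z)
      simp only
      nlinarith
    rw [integral_const_mul, integral_add_left_eq_self] at h1
    have h2 : ∫ y, v y ≤ (∫ y, F y) / lam := by
      rw [le_div_iff₀ hlam]
      linarith
    calc M 1 ≤ 6 * ∫ y, v y := h1
      _ ≤ 6 * ((∫ y, F y) / lam) := by linarith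
      _ = _ := by ring
  rw [div_mul_eq_mul_div, le_div_iff₀ hG]
  have h1 : 0 ≤ 6 / lam * Φ := by positivity
  have h2 : 0 ≤ A / α * ∫ y, F y := by positivity
  have h3 : A * Φ / α = A / α * Φ := by ring
  rw [hM0, h3] at hmono
  linarith

end SupEstimate

/-! ### From smooth subsolutions back to the strong solution. -/

section Approximation

open Filter Topology

variable {d : ℕ}

local notation "𝔼" => EuclideanSpace ℝ (Fin d)

/-- A bound for all smooth compactly supported subsolutions passes to the positive part of a
strong solution. -/
lemma IsStrongSolution.eLpNorm_posPart_le {Ω : Set 𝔼} (hΩ : IsBoundedC2Domain Ω) {q lam : ℝ}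
    (hq : 1 ≤ q) (hlam : 0 ≤ lam) {H : 𝔼 → 𝔼 → ℝ} {f u : 𝔼 → ℝ}
    (hH : ∀ x ∈ Ω, ∀ ξ, 0 ≤ H x ξ) (hf : MemLp f (ENNReal.ofReal q) (volume.restrict Ω))
    (h : IsStrongSolution Ω (ENNReal.ofReal q) lam H f u) {P B : ℝ≥0∞}
    (hB : ∀ v F : 𝔼 → ℝ, ContDiff ℝ 2 v → HasCompactSupport v → (∀ x, 0 ≤ v x) →
      Continuous F → HasCompactSupport F → (∀ x, 0 ≤ F x) →
      (∀ x, lam * v x - F x ≤ laplace v x) → (∫ x, F x = ∫ x in Ω, max (f x) 0) →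
      eLpNorm F (ENNReal.ofReal q) volume
        ≤ eLpNorm (fun x => max (f x) 0) (ENNReal.ofReal q) (volume.restrict Ω) →
      eLpNorm v P volume ≤ B) :
    eLpNorm (fun x => max (u x) 0) P (volume.restrict Ω) ≤ B := by
  have hm := hΩ.isOpen.measurableSet
  have hfin : volume Ω ≠ ⊤ := hΩ.isBounded.measure_lt_top.ne
  have : IsFiniteMeasure (volume.restrict Ω) := ⟨by simpa using hfin.lt_top⟩
  have hq' : 1 ≤ ENNReal.ofReal q := by simpa using hq
  have hu1 : IntegrableOn u Ω := h.memW2.1.integrable hq'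
  have hf1 : IntegrableOn f Ω := hf.integrable hq'
  obtain ⟨ε₀, hε₀, hsub⟩ := h.exists_mollify_posPart_subsolution hΩ hq' hlam hH hu1 hf1
  set p : 𝔼 → ℝ := Ω.indicator fun y => max (u y) 0
  set g : 𝔼 → ℝ := Ω.indicator fun y => max (f y) 0
  have hp : Integrable p := (integrable_indicator_iff hm).2 hu1.pos_part
  have hg : Integrable g := (integrable_indicator_iff hm).2 hf1.pos_part
  have hK : IsCompact (closure Ω) := hΩ.isBounded.isCompact_closure
  have hcs : ∀ w : 𝔼 → ℝ, HasCompactSupport (Ω.indicator w) := fun w =>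
    HasCompactSupport.intro hK fun x hx =>
      Set.indicator_of_notMem (fun hxΩ => hx (subset_closure hxΩ)) _
  have hp0 : ∀ x, 0 ≤ p x := Set.indicator_nonneg fun x _ => le_max_right _ _
  have hg0 : ∀ x, 0 ≤ g x := Set.indicator_nonneg fun x _ => le_max_right _ _
  have hbound : ∀ᶠ n in atTop, eLpNorm (mollify (shrinkingBump n) p) P volume ≤ B := by
    filter_upwards [tendsto_shrinkingBump_rOut.eventually (gt_mem_nhds hε₀)] with n hn
    refine hB _ (mollify (shrinkingBump n) g) (contDiff_mollify _ hp (n := 2))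
      (hasCompactSupport_mollify _ (hcs _)) (mollify_nonneg _ hp0)
      (contDiff_mollify _ hg (n := 0)).continuous (hasCompactSupport_mollify _ (hcs _))
      (mollify_nonneg _ hg0) (hsub _ hn) ?_ ?_
    · rw [integral_mollify _ hg, integral_indicator hm]
    · refine (eLpNorm_mollify_le _ hg hq).trans_eq ?_
      rw [eLpNorm_indicator_eq_eLpNorm_restrict hm]
  rw [← eLpNorm_indicator_eq_eLpNorm_restrict hm]
  -- Lower semicontinuity under almost everywhere convergence covers every exponent `P`, including
  -- `∞`.
  refine (Lp.eLpNorm_lim_le_liminf_eLpNorm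
    (fun n => (integrable_mollify (shrinkingBump n) hp).aestronglyMeasurable) p
    (ae_tendsto_mollify hp)).trans ?_
  exact liminf_le_of_frequently_le' hbound.frequently

end Approximation

/-! ### The two estimates. -/

theorem proposition4p1 (d : ℕ) (hd : 2 ≤ d) (q : ℝ) (hq : 2 * (d : ℝ) / ((d : ℝ) + 2) < q)
    (V : ℝ≥0∞) :
    (q < (d : ℝ) / 2 →
      ∃ C₀ : ℝ, 0 < C₀ ∧
        ∀ lam : ℝ, 0 < lam →
        ∀ (Ω : Set (EuclideanSpace ℝ (Fin d)))
          (H : EuclideanSpace ℝ (Fin d) → EuclideanSpace ℝ (Fin d) → ℝ)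
          (f u : EuclideanSpace ℝ (Fin d) → ℝ),
          IsBoundedC2Domain Ω → volume Ω = V →
          (∀ x ∈ Ω, ∀ ξ, 0 ≤ H x ξ) →
          MemLp f (ENNReal.ofReal q) (volume.restrict Ω) →
          IsStrongSolution Ω (ENNReal.ofReal q) lam H f u →
          eLpNorm (fun x => max (u x) 0) (ENNReal.ofReal ((d : ℝ) * q / ((d : ℝ) - 2 * q)))
              (volume.restrict Ω)
            ≤ ENNReal.ofReal C₀ *
              eLpNorm (fun x => max (f x) 0) (ENNReal.ofReal q) (volume.restrict Ω)) ∧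
    ((d : ℝ) / 2 < q →
      ∀ lam : ℝ, 0 < lam →
      ∃ C₀ : ℝ, 0 < C₀ ∧
        ∀ (Ω : Set (EuclideanSpace ℝ (Fin d)))
          (H : EuclideanSpace ℝ (Fin d) → EuclideanSpace ℝ (Fin d) → ℝ)
          (f u : EuclideanSpace ℝ (Fin d) → ℝ),
          IsBoundedC2Domain Ω → volume Ω = V →
          (∀ x ∈ Ω, ∀ ξ, 0 ≤ H x ξ) →
          MemLp f (ENNReal.ofReal q) (volume.restrict Ω) →
          IsStrongSolution Ω (ENNReal.ofReal q) lam H f u →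
          eLpNorm (fun x => max (u x) 0) ∞ (volume.restrict Ω)
            ≤ ENNReal.ofReal C₀ *
              eLpNorm (fun x => max (f x) 0) (ENNReal.ofReal q) (volume.restrict Ω)) := by
  have hd0 : (2 : ℝ) ≤ d := by exact_mod_cast hd
  have hq1 : 1 < q := by
    refine lt_of_le_of_lt ?_ hq
    rw [le_div_iff₀ (by linarith)]
    linarith
  have hq0 : 0 < q := by linarith
  refine ⟨fun hqd => ?_, fun hqd lam hlam => ?_⟩
  · obtain ⟨C, hC, hest⟩ := exists_Lp_estimate hq hqd
    refine ⟨C, hC, fun lam hlam Ω H f u hΩ _ hH hf hu => ?_⟩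
    refine hu.eLpNorm_posPart_le hΩ hq1.le hlam.le hH hf
      fun v F hv hvc hv0 hF hFc hF0 h _ hFq => ?_
    refine (hest v F hv hvc hv0 hF hFc hF0 fun x => ?_).trans (by gcongr)
    -- Dropping `lam * v ≥ 0` here is what keeps the constant independent of `lam`.
    linarith [h x, mul_nonneg hlam.le (hv0 x)]
  · obtain ⟨C, hC, hest⟩ := exists_sup_estimate hq1 hqd hlam
    -- The Hölder factor bounding the mass of `f⁺` by its `L^q` norm. For `V = ⊤` its `toReal` is
    -- the default `0`, harmless since a bounded domain has finite volume.
    set A : ℝ≥0∞ := V ^ (1 - 1 / q)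
    refine ⟨C * (A.toReal + 1), by positivity, fun Ω H f u hΩ hV hH hf hu => ?_⟩
    refine hu.eLpNorm_posPart_le hΩ hq1.le hlam.le hH hf
      fun v F hv hvc hv0 hF hFc hF0 h hFi hFq => ?_
    have hfin : V ≠ ⊤ := hV ▸ hΩ.isBounded.measure_lt_top.ne
    have hA : A ≠ ⊤ := ENNReal.rpow_ne_top_of_nonneg
      (by rw [sub_nonneg, div_le_one hq0]; exact hq1.le) hfin
    have hfp : MemLp (fun x => max (f x) 0) (ENNReal.ofReal q) (volume.restrict Ω) := hf.pos_part
    have : IsFiniteMeasure (volume.restrict Ω) := ⟨by simpa [hV] using hfin.lt_top⟩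
    have hfi : Integrable (fun x => max (f x) 0) (volume.restrict Ω) :=
      hfp.integrable (by simpa using hq1.le)
    set Φ := (eLpNorm (fun x => max (f x) 0) (ENNReal.ofReal q) (volume.restrict Ω)).toReal
    have hΦ : ENNReal.ofReal Φ
        = eLpNorm (fun x => max (f x) 0) (ENNReal.ofReal q) (volume.restrict Ω) :=
      ENNReal.ofReal_toReal hfp.eLpNorm_ne_top
    have hmass : ∫ x, F x ≤ Φ * A.toReal := by
      have h1 := eLpNorm_le_eLpNorm_mul_rpow_measure_univ (p := 1) (q := ENNReal.ofReal q)
        (by simpa using hq1.le) hfp.1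
      rw [eLpNorm_one_eq_lintegral_enorm, ← ofReal_integral_norm_eq_lintegral_enorm hfi, ← hΦ,
        Measure.restrict_apply_univ, hV, ENNReal.toReal_one, ENNReal.toReal_ofReal hq0.le,
        div_one] at h1
      simp only [Real.norm_of_nonneg (le_max_right _ (0 : ℝ))] at h1
      rw [hFi]
      have h2 := ENNReal.toReal_mono (ENNReal.mul_ne_top ENNReal.ofReal_ne_top hA) h1
      have h3 : 0 ≤ ∫ x in Ω, max (f x) 0 := integral_nonneg fun x => le_max_right (f x) 0
      rwa [ENNReal.toReal_ofReal h3, ENNReal.toReal_mul,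
        ENNReal.toReal_ofReal ENNReal.toReal_nonneg] at h2
    have hnorm : (∫ x, F x ^ q) ^ (1 / q) ≤ Φ := by
      rw [← hΦ, (hF.memLp_of_hasCompactSupport hFc).eLpNorm_eq_integral_rpow_norm
        (by simpa using hq0) ENNReal.ofReal_ne_top, ENNReal.toReal_ofReal hq0.le] at hFq
      simp only [Real.norm_of_nonneg (hF0 _)] at hFq
      rw [one_div]
      exact (ENNReal.ofReal_le_ofReal_iff ENNReal.toReal_nonneg).1 hFq
    rw [← hΦ, ← ENNReal.ofReal_mul (by positivity), eLpNorm_exponent_top]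
    refine eLpNormEssSup_le_of_ae_bound (ae_of_all _ fun x => ?_)
    rw [Real.norm_of_nonneg (hv0 x)]
    refine (hest v F hv hvc hv0 hF hFc hF0 h x).trans ?_
    rw [mul_assoc]
    refine mul_le_mul_of_nonneg_left ?_ hC.le
    linarith
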